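/- **Setting.** For $\varphi,l,\delta\in\mathbb{R}$ let $[(\varphi,l),\uparrow_\delta]\subset\mathbb{R}^3$ be the line tangent to the unit sphere at the point of latitude $\varphi$ and longitude $l$, whose direction is obtained from the unit tangent vector pointing North by rotating it by the angle $\delta$, counterclockwise when viewed from outside the sphere. For labels $J\in\{A,B,C,D,E,F\}$ put $$J(\varkappa,\varphi,\delta)=[(\varphi,l_J+\varkappa),\uparrow_\delta]\ \ (J=A,B,C),\qquad J(\varkappa,\varphi,\delta)=[(-\varphi,l_J-\varkappa),\uparrow_\delta]\ \ (J=D,E,F),$$ where $l_A=\frac{\pi}{6}$, $l_B=\frac{5\pi}{6}$, $l_C=\frac{3\pi}{2}$, $l_D=\frac{\pi}{2}$, $l_E=\frac{7\pi}{6}$, $l_F=\frac{11\pi}{6}$. For $0<x<1$ let $$\varphi(x)=\arcsin\Bigl(2\sqrt{\tfrac{(1-x)x(1+x)}{1+7x+4x^2}}\Bigr),\quad \delta(x)=\arctan\sqrt{\tfrac{(1-x)(1+3x)}{x(1+7x+4x^2)}},\quad \varkappa(x)=\arctan\tfrac{x-1}{\sqrt{(1+x)(1+3x)}},$$ and let $C_{6,x}$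 be the configuration of the six lines $J(\varkappa(x),\varphi(x),\delta(x))$. Given normalization constants $\vartheta_\varkappa,\vartheta_\varphi,\vartheta_\delta>0$ and $18$ real perturbation parameters $J_\varkappa,J_\varphi,J_\delta$ ($J\in\{A,\dots,F\}$), the perturbed lines are $$J(\varkappa(x)+\vartheta_\varkappa J_\varkappa,\ \varphi(x)+\vartheta_\varphi J_\varphi,\ \delta(x)+\vartheta_\delta J_\delta),$$ and for $J\neq L$ we denote by $d(JL)^2$ the square of the distance between the perturbed lines $J$ and $L$, as a function of the parameters, and by $[d(JL)^2]_k$ the homogeneous part of degree $k$ of its Taylor expansion at the origin. (Fixing the line $A$ amounts to setting $A_\varkappa=A_\varphi=A_\delta=0$.) For a field $K$ and a permutation $\pi$ of the labels let $\Pi_\pi$ be the $K$-algebra automorphism $J_\upsilon\mapsto\pi(J)_\upsilon$ of the polynomial ring $K[J_\upsilon]$ in the $18$ variables. Let $$\varpi=(A,B,C)(D,E,F),\qquad \varrho=(A,D)(B,F)(C,E),\qquad \varsigma=(B,C)(D,F).$$ **Proposition.** Let $x$ be a rational number, $0<x<1$, such that $\mathfrak p_x=\sqrt{(1+x)(1+3x)/3}$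 is irrational, and let $\iota$ be the Galois conjugation $\mathfrak p_x\mapsto-\mathfrak p_x$ of $K=\mathbb{Q}[\mathfrak p_x]$. There is a choice of the constants $\vartheta_\varkappa,\vartheta_\varphi,\vartheta_\delta>0$ such that the following holds. (i) All fifteen squared distances $d(JL)^2$ are analytic at the origin, and all their Taylor coefficients belong to $\mathbb{Q}[\mathfrak p_x]$; thus $[d(JL)^2]_k\in K[J_\upsilon]$. (ii) Let $\Pi_\varsigma$ be the ring automorphism of $K[J_\upsilon]$ that acts on the coefficients by $\iota$ and on the variables by the signed permutation $$J_\varkappa\mapsto-\varsigma(J)_\varkappa,\qquad J_\varphi\mapsto\varsigma(J)_\varphi,\qquad J_\delta\mapsto-\varsigma(J)_\delta .$$ Then the group $G$ generated by $\Pi_\varpi$, $\Pi_\varrho$ and $\Pi_\varsigma$ is the dihedral group $\mathbb{D}_6$ of order $12$; it acts faithfully on the labels, with $\Pi_\varpi,\Pi_\varrho,\Pi_\varsigma$ acting by $\varpi,\varrho,\varsigma$; and it permutes the Taylor expansions of the squared distances accordingly: if $g\in G$ acts on the labels by $\pi$, then $$g\bigl([d(JL)^2]_k\bigr)=[d(\pi(J)\pi(L))^2]_k\qquad\text{for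 all } J\neq L \text{ and all } k\ge 0 .$$ -/

import Mathlib

namespace SixLines

/-- The six tangent lines. -/
inductive Label
  | A | B | C | D | E | F
  deriving DecidableEq

instance : Fintype Label :=
  ⟨{Label.A, Label.B, Label.C, Label.D, Label.E, Label.F}, fun J => by cases J <;> decide⟩

/-- The three kinds of coordinates: longitude parameter, latitude parameter, inclination. -/
inductive Coord
  | kappa | phi | delta
  deriving DecidableEq

instance : Fintype Coord :=
  ⟨{Coord.kappa, Coord.phi, Coord.delta}, fun υ => by cases υ <;> decide⟩

open Label Coord

noncomputable section

/-! ### Tangent lines of the unit sphere and their distances -/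

/-- Ordinary Euclidean three-space. -/
abbrev Space := EuclideanSpace ℝ (Fin 3)

/-- The point of the unit sphere with latitude `φ` and longitude `l`. -/
def spherePoint (φ l : ℝ) : Space :=
  !₂[Real.cos φ * Real.cos l, Real.cos φ * Real.sin l, Real.sin φ]

/-- The unit tangent vector at `spherePoint φ l` that points to the North. -/
def northVec (φ l : ℝ) : Space :=
  !₂[-(Real.sin φ * Real.cos l), -(Real.sin φ * Real.sin l), Real.cos φ]

/-- The unit tangent vector at a point of longitude `l` that points to the East. -/
def eastVec (l : ℝ) : Space := !₂[-Real.sin l, Real.cos l, 0]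

/-- The North vector rotated by the angle `δ` about the axis through the point of tangency,
counterclockwise when viewed from outside the sphere, that is, from North towards West. -/
def direction (φ l δ : ℝ) : Space := Real.cos δ • northVec φ l - Real.sin δ • eastVec l

/-- The tangent line `[(φ, l), ↑_δ]`. -/
def tangentLine (φ l δ : ℝ) : Set Space :=
  Set.range fun s : ℝ => spherePoint φ l + s • direction φ l δ

/-- The distance between two lines (the infimum of the distances between their points). -/
def lineDist (u v : Set Space) : ℝ := sInf (Set.image2 dist u v)

/-! ### The configurations `C₆(φ, δ, ϰ)` and `C_{6,x}` -/

/-- Longitudes of the six vertical lines of the configuration `C₆(0, 0, 0)`. -/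
def longitude : Label → ℝ
  | A => Real.pi / 6
  | B => 5 * Real.pi / 6
  | C => 3 * Real.pi / 2
  | D => Real.pi / 2
  | E => 7 * Real.pi / 6
  | F => 11 * Real.pi / 6

/-- The lines `A, B, C` move to the North, the lines `D, E, F` to the South. -/
def side : Label → ℝ
  | A => 1
  | B => 1
  | C => 1
  | D => -1
  | E => -1
  | F => -1

/-- The line `J(ϰ, φ, δ)`: it is `[(φ, l + ϰ), ↑_δ]` for `J = A, B, C` and `[(-φ, l - ϰ), ↑_δ]`
for `J = D, E, F`, where `l` is the longitude of `J` in `C₆(0, 0, 0)`. The six lines with common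
parameters form the configuration `C₆(φ, δ, ϰ)`. -/
def lineAt (J : Label) (a : Coord → ℝ) : Set Space :=
  tangentLine (side J * a phi) (longitude J + side J * a kappa) (a delta)

/-- The number `𝔭_x`. -/
def pX (x : ℝ) : ℝ := √((1 + x) * (1 + 3 * x) / 3)

/-- The angles `ϰ(x)`, `φ(x)`, `δ(x)` of the configuration `C_{6,x}`. -/
def baseAngle (x : ℝ) : Coord → ℝ
  | kappa => Real.arctan ((x - 1) / √((1 + x) * (1 + 3 * x)))
  | phi => Real.arcsin (2 * √((1 - x) * x * (1 + x) / (1 + 7 * x + 4 * x ^ 2)))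
  | delta => Real.arctan √((1 - x) * (1 + 3 * x) / (x * (1 + 7 * x + 4 * x ^ 2)))

/-- The perturbed line `J` of `C_{6,x}`: its coordinate of kind `υ` is the one in `C_{6,x}`
plus `ϑ_υ · J_υ`, where `J_υ` is the perturbation parameter `y (J, υ)` and `ϑ_υ` is a
normalization constant. -/
def perturbedLine (x : ℝ) (ϑ : Coord → ℝ) (y : Label × Coord → ℝ) (J : Label) : Set Space :=
  lineAt J fun υ => baseAngle x υ + ϑ υ * y (J, υ)

/-- The squared distance between the perturbed lines `J` and `L`, as a function of the
(normalized) perturbation parameters. -/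
def sqDist (x : ℝ) (ϑ : Coord → ℝ) (J L : Label) (y : Label × Coord → ℝ) : ℝ :=
  lineDist (perturbedLine x ϑ y J) (perturbedLine x ϑ y L) ^ 2

/-! ### Taylor coefficients at the origin -/

section Taylor

variable {ι : Type} [Fintype ι] [DecidableEq ι]

/-- The partial derivative `∂f/∂y_i`. -/
def partialDeriv (i : ι) (f : (ι → ℝ) → ℝ) : (ι → ℝ) → ℝ :=
  fun y => fderiv ℝ f y (Pi.single i 1)

/-- The iterated partial derivative along a list of variables. -/
def iteratedPartial (l : List ι) (f : (ι → ℝ) → ℝ) : (ι → ℝ) → ℝ :=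
  l.foldr partialDeriv f

/-- The Taylor coefficient of `f` at `0` at the monomial `y ^ n`, that is, `∂ⁿf(0) / n!` for the
multi-index `n` (for smooth `f` the order of the differentiations does not matter). -/
def taylorCoeff (f : (ι → ℝ) → ℝ) (n : ι →₀ ℕ) : ℝ :=
  iteratedPartial (Finsupp.toMultiset n).toList f 0 / ∏ i, ((n i).factorial : ℝ)

/-- The homogeneous part `[f]_k` of degree `k` of the Taylor expansion of `f` at `0`. -/
def taylorPart (k : ℕ) (f : (ι → ℝ) → ℝ) : MvPolynomial ι ℝ :=
  ∑ n ∈ Finset.finsuppAntidiag Finset.univ k, MvPolynomial.monomial n (taylorCoeff f n)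

end Taylor

/-! ### The operators -/

section Operators

variable {K : Type} [Field K]

/-- Polynomials in the perturbation parameters `J_υ`. The linear forms among them are the
`K`-span of the symbols `J_υ`; the symmetric powers of this space are the spaces of forms of
higher degree. -/
abbrev Forms (K : Type) [Field K] := MvPolynomial (Label × Coord) K

/-- The ring endomorphism with `J_υ ↦ ε_υ · π(J)_υ` that acts by `σ` on the coefficients. -/
def signedPermHom (σ : K ≃+* K) (π : Equiv.Perm Label) (ε : Coord → ℤˣ) :
    Forms K →+* Forms K :=
  MvPolynomial.eval₂Hom (MvPolynomial.C.comp (σ : K →+* K))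
    fun i => MvPolynomial.C (((ε i.2 : ℤˣ) : ℤ) : K) * MvPolynomial.X (π i.1, i.2)

theorem signedPermHom_comp (σ τ : K ≃+* K) (π ρ : Equiv.Perm Label) (ε : Coord → ℤˣ)
    (h₁ : ∀ a, σ (τ a) = a) (h₂ : ∀ J, π (ρ J) = J) :
    (signedPermHom σ π ε).comp (signedPermHom τ ρ ε) = RingHom.id _ := by
  refine MvPolynomial.ringHom_ext (fun a => ?_) (fun i => ?_)
  · simp [signedPermHom, h₁]
  · simp only [signedPermHom, RingHom.comp_apply, MvPolynomial.coe_eval₂Hom,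
      MvPolynomial.eval₂_X, MvPolynomial.eval₂_mul, MvPolynomial.eval₂_C, RingHom.id_apply, h₂]
    rw [← mul_assoc]
    have h : ((ε i.2 : ℤˣ) : ℤ) * ((ε i.2 : ℤˣ) : ℤ) = 1 := by
      rw [← Units.val_mul, Int.units_mul_self]; rfl
    have h' : (((ε i.2 : ℤˣ) : ℤ) : K) * (((ε i.2 : ℤˣ) : ℤ) : K) = 1 := by
      rw [← Int.cast_mul, h, Int.cast_one]
    simp only [map_intCast]
    rw [← map_intCast (MvPolynomial.C : K →+* Forms K), ← map_mul, h', map_one, one_mul]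

/-- The ring automorphism with `J_υ ↦ ε_υ · π(J)_υ` that acts by `σ` on the coefficients: the
natural extension to forms of all degrees of this semilinear operator on linear forms. -/
def signedPerm (σ : K ≃+* K) (π : Equiv.Perm Label) (ε : Coord → ℤˣ) : RingAut (Forms K) :=
  RingEquiv.ofRingHom (signedPermHom σ π ε) (signedPermHom σ.symm π.symm ε)
    (signedPermHom_comp σ σ.symm π π.symm ε σ.apply_symm_apply π.apply_symm_apply)
    (signedPermHom_comp σ.symm σ π.symm π ε σ.symm_apply_apply π.symm_apply_apply)

theorem signedPerm_C (σ : K ≃+* K) (π : Equiv.Perm Label) (ε : Coord → ℤˣ) (a : K) :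
    signedPerm σ π ε (MvPolynomial.C a) = MvPolynomial.C (σ a) := by
  change signedPermHom σ π ε _ = _
  simp [signedPermHom]

theorem signedPerm_X (σ : K ≃+* K) (π : Equiv.Perm Label) (ε : Coord → ℤˣ) (i : Label × Coord) :
    signedPerm σ π ε (MvPolynomial.X i) =
      MvPolynomial.C (((ε i.2 : ℤˣ) : ℤ) : K) * MvPolynomial.X (π i.1, i.2) := by
  change signedPermHom σ π ε _ = _
  simp [signedPermHom]

/-- The permutation `(A,B,C)(D,E,F)`. -/
def varpi : Equiv.Perm Label := [A, B, C].formPerm * [D, E, F].formPerm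

/-- The permutation `(A,D)(B,F)(C,E)`. -/
def varrho : Equiv.Perm Label := Equiv.swap A D * Equiv.swap B F * Equiv.swap C E

/-- The permutation `(B,C)(D,F)`. -/
def varsigma : Equiv.Perm Label := Equiv.swap B C * Equiv.swap D F

/-- The signs in `J_ϰ ↦ -ς(J)_ϰ`, `J_φ ↦ ς(J)_φ`, `J_δ ↦ -ς(J)_δ`. -/
def signs : Coord → ℤˣ
  | kappa => -1
  | phi => 1
  | delta => -1

variable (K) in
/-- The operator `Π_ϖ`. -/
def opVarpi : RingAut (Forms K) := signedPerm (RingEquiv.refl K) varpi 1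

variable (K) in
/-- The operator `Π_ϱ`. -/
def opVarrho : RingAut (Forms K) := signedPerm (RingEquiv.refl K) varrho 1

/-- The operator `Π_ς`, for the automorphism `conj` of the field of coefficients. -/
def opVarsigma (conj : K ≃+* K) : RingAut (Forms K) := signedPerm conj varsigma signs

end Operators

end

end SixLines

open SixLines
open scoped IntermediateField

/-!
The squared distance of two lines is the square of a mixed product divided by the squared length of a
cross product (`lineDist_tangentLine_sq`), hence a rational expression in the sines and cosines of the
latitudes and of the difference `Δ` of the longitudes and in the tangents of the inclinations. Divide
the sines and cosines of the latitudes and the tangents by their values `sin φ(x)`, `cos φ(x)`,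
`tan δ(x)` in the configuration, and `sin Δ` by `√3`. These divisors need not lie in `ℚ[𝔭_x]`, but they
enter the expression only through the rational numbers `sin² φ(x)`, `cos² φ(x)`, `tan² δ(x)` and the
product `√3 tan δ(x) sin φ(x)`, which is a rational multiple of `𝔭_x` (`sqrt_three_mul_tan_mul_sin`,
`sqDist_eventuallyEq`).

With `ϑ_ϰ = √3`, `ϑ_φ = sin φ(x) cos φ(x)`, `ϑ_δ = 𝔭_x tan δ(x)`, the normalized functions take values
in `ℚ[𝔭_x]` at the origin and solve differential equations with coefficients in `ℚ[𝔭_x]`: linear ones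
for the sines and cosines (`conjugateJets_cos_sin`), a Riccati equation for the tangents
(`conjugateJets_tan`). Consequently all their derivatives at the origin lie in `ℚ[𝔭_x]`, and an
operator that is compatible with the values and with the equations carries the Taylor expansions of
the normalized functions into each other. This compatibility is the relation `ConjugateJets`, defined by
recursion on the order of the derivatives; it passes to sums, products and inverses, and therefore from
the normalized functions to the squared distances (`conjugateJets_sqDist`).

The denominators do not vanish at the origin (`normDot_ne`). For lines on the same side of the equator
this is a direct estimate. Parallel lines on different sides would be an equality case of the
Cauchy-Schwarz inequality, which prescribes a rational value of `cos Δ`. When `Δ = ±π/3 ± 2ϰ(x)`, this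
cosine has an irrational part because `𝔭_x` is irrational, and when `Δ = π ± 2ϰ(x)`, it has another
value.

On the group side, `ϱς` has order `6`, its square is `ϖ`, and `ϱ` inverts it. The operators depend
multiplicatively on the automorphism of the coefficients, the permutation and the signs
(`signedPerm_mul`), so that the relations of the dihedral group hold for them as well.
-/

namespace SixLines

open Label Coord
open scoped IntermediateField Topology Polynomial

/-! ### The dihedral group -/

/-- Elements `R`, `S` of a group that satisfy the relations of the dihedral group of order `2n`
define a homomorphism with `r 1 ↦ R` and `sr 0 ↦ S`. -/
def dihedralLift {G : Type*} [Group G] {n : ℕ} (R S : G) (hR : R ^ n = 1) (hS : S * S = 1)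
    (hSR : S * R = R⁻¹ * S) : DihedralGroup n →* G :=
  let f : ZMod n →+ Additive G :=
    ZMod.lift n ⟨zmultiplesHom (Additive G) (Additive.ofMul R), by simp [← ofMul_pow, hR]⟩
  have hf (i : ZMod n) : S * (f i).toMul = (f (-i)).toMul * S := by
    obtain ⟨k, rfl⟩ := ZMod.intCast_surjective i
    rw [← Int.cast_neg]
    simp only [f, ZMod.lift_coe, zmultiplesHom_apply, toMul_zsmul, toMul_ofMul]
    have h : SemiconjBy S R R⁻¹ := hSR
    simpa [SemiconjBy] using h.zpow_right k
  MonoidHom.mk'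
    (fun
      | .r i => (f i).toMul
      | .sr i => S * (f i).toMul)
    (by
      rintro (i | i) (j | j)
      · simp [DihedralGroup.r_mul_r]
      · simp only [DihedralGroup.r_mul_sr]
        rw [← mul_assoc, ← neg_neg i, ← hf, mul_assoc, ← toMul_add, ← map_add]
        congr 3; abel_nf
      · simp [DihedralGroup.sr_mul_r, mul_assoc]
      · simp only [DihedralGroup.sr_mul_sr]
        rw [mul_assoc, ← mul_assoc _ S, ← neg_neg i, ← hf, mul_assoc, ← mul_assoc, hS, one_mul,
          ← toMul_add, ← map_add]
        congr 2; abel_nf)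

theorem dihedralLift_r_one {G : Type*} [Group G] {n : ℕ} (R S : G) (hR : R ^ n = 1)
    (hS : S * S = 1) (hSR : S * R = R⁻¹ * S) :
    dihedralLift R S hR hS hSR (.r 1) = R := by
  have h : ((1 : ℤ) : ZMod n) = 1 := Int.cast_one
  simp only [dihedralLift, MonoidHom.mk'_apply, ← h, ZMod.lift_coe]
  simp

theorem dihedralLift_sr_zero {G : Type*} [Group G] {n : ℕ} (R S : G) (hR : R ^ n = 1)
    (hS : S * S = 1) (hSR : S * R = R⁻¹ * S) :
    dihedralLift R S hR hS hSR (.sr 0) = S := by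
  simp [dihedralLift]

/-! ### The signed permutation operators -/

section Operators

variable {K : Type} [Field K]

/-- Composition of signed permutation operators: the data `(σ, π, ε)` multiply componentwise,
because the signs depend only on the kind of the coordinate, which is not permuted. -/
theorem signedPerm_mul (σ τ : K ≃+* K) (π ρ : Equiv.Perm Label) (ε η : Coord → ℤˣ) :
    signedPerm σ π ε * signedPerm τ ρ η = signedPerm (σ * τ) (π * ρ) (ε * η) := by
  apply RingEquiv.toRingHom_injective
  refine MvPolynomial.ringHom_ext (fun a => ?_) (fun i => ?_)
  · change signedPerm σ π ε (signedPerm τ ρ η _) = signedPerm (σ * τ) (π * ρ) (ε * η) _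
    simp [signedPerm_C]
  · change signedPerm σ π ε (signedPerm τ ρ η _) = signedPerm (σ * τ) (π * ρ) (ε * η) _
    simp only [signedPerm_X, map_mul, map_intCast, Pi.mul_apply, Units.val_mul,
      Int.cast_mul, Equiv.Perm.coe_mul, Function.comp_apply]
    ring

theorem signedPerm_one : signedPerm (1 : K ≃+* K) 1 1 = 1 := by
  apply RingEquiv.toRingHom_injective
  refine MvPolynomial.ringHom_ext (fun a => ?_) (fun i => ?_)
  · change signedPerm (1 : K ≃+* K) 1 1 _ = MvPolynomial.C a
    simp [signedPerm_C]
  · change signedPerm (1 : K ≃+* K) 1 1 _ = MvPolynomial.X i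
    simp [signedPerm_X]

variable (K) in
/-- The signed permutation operators as a homomorphism on the group of the data `(σ, π, ε)`. -/
noncomputable def signedPermMonoidHom :
    ((K ≃+* K) × Equiv.Perm Label × (Coord → ℤˣ)) →* RingAut (Forms K) where
  toFun t := signedPerm t.1 t.2.1 t.2.2
  map_one' := signedPerm_one
  map_mul' s t := (signedPerm_mul s.1 t.1 s.2.1 t.2.1 s.2.2 t.2.2).symm

theorem eq_one_of_signedPerm_eq_one {σ : K ≃+* K} {π : Equiv.Perm Label} {ε : Coord → ℤˣ}
    (h : signedPerm σ π ε = 1) : π = 1 := by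
  ext J
  have h1 : signedPerm σ π ε (.X (J, phi)) = .X (J, phi) := by rw [h]; rfl
  rw [signedPerm_X] at h1
  have h2 := congrArg (MvPolynomial.coeff (Finsupp.single (J, phi) 1)) h1
  rw [MvPolynomial.coeff_C_mul, MvPolynomial.coeff_X, MvPolynomial.coeff_X] at h2
  by_contra hne
  rw [if_neg] at h2
  · simp at h2
  · intro h3
    have := (Finsupp.single_left_inj one_ne_zero).1 h3
    exact hne (Prod.ext_iff.1 this).1

/-- On monomials, a signed permutation operator permutes the exponents and multiplies the
coefficient by the product of the signs. -/
theorem signedPerm_monomial (σ : K ≃+* K) (π : Equiv.Perm Label) (ε : Coord → ℤˣ)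
    (n : Label × Coord →₀ ℕ) (a : K) :
    signedPerm σ π ε (MvPolynomial.monomial n a) =
      MvPolynomial.monomial (n.mapDomain (π.prodCongr (Equiv.refl Coord)))
        ((((∏ i, ε i.2 ^ n i : ℤˣ) : ℤ) : K) * σ a) := by
  rw [MvPolynomial.monomial_eq, MvPolynomial.monomial_eq, map_mul, signedPerm_C,
    Finsupp.prod_mapDomain_index_inj (Equiv.injective _), Finsupp.prod_fintype _ _ (by simp),
    Finsupp.prod_fintype _ _ (by simp), map_prod]
  simp only [map_pow, signedPerm_X, mul_pow, Finset.prod_mul_distrib, map_mul, Units.coe_prod,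
    Int.cast_prod, map_prod, Units.val_pow_eq_pow_val, Int.cast_pow, Equiv.prodCongr_apply,
    Prod.map, Equiv.refl_apply]
  ring

theorem coeff_signedPerm (σ : K ≃+* K) (π : Equiv.Perm Label) (ε : Coord → ℤˣ)
    (n : Label × Coord →₀ ℕ) (P : Forms K) :
    (signedPerm σ π ε P).coeff (n.mapDomain (π.prodCongr (Equiv.refl Coord))) =
      (((∏ i, ε i.2 ^ n i : ℤˣ) : ℤ) : K) * σ (P.coeff n) := by
  classical
  induction P using MvPolynomial.induction_on' with
  | monomial m a =>
    rw [signedPerm_monomial, MvPolynomial.coeff_monomial, MvPolynomial.coeff_monomial]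
    by_cases h : m = n
    · simp [h]
    · rw [if_neg h, if_neg, map_zero, mul_zero]
      exact fun h' => h (Finsupp.mapDomain_injective (Equiv.injective _) h')
  | add p q hp hq => simp only [map_add, MvPolynomial.coeff_add, hp, hq, mul_add]

end Operators

/-! ### The group generated by the three permutations -/

theorem varpi_eq : varpi = varrho * varsigma * (varrho * varsigma) := by
  ext J; cases J <;> rfl

theorem varrho_mul_self : varrho * varrho = 1 := by
  ext J; cases J <;> rfl

theorem varsigma_mul_self : varsigma * varsigma = 1 := by
  ext J; cases J <;> rfl

theorem varpi_pow_three : varpi ^ 3 = 1 := by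
  rw [pow_three]; ext J; cases J <;> rfl

/-! ### Iterated partial derivatives of analytic functions -/

section Partial

variable {ι : Type} [DecidableEq ι] {f g : (ι → ℝ) → ℝ} {x : ι → ℝ}

theorem partialDeriv_congr (h : f =ᶠ[𝓝 x] g) (i : ι) :
    partialDeriv i f =ᶠ[𝓝 x] partialDeriv i g :=
  (h.fderiv (𝕜 := ℝ)).mono fun y hy => by simp only [partialDeriv, hy]

theorem iteratedPartial_concat (l : List ι) (i : ι) (f : (ι → ℝ) → ℝ) :
    iteratedPartial (l ++ [i]) f = iteratedPartial l (partialDeriv i f) := by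
  simp [iteratedPartial]

theorem partialDeriv_const (c : ℝ) (i : ι) :
    partialDeriv i (fun _ : ι → ℝ => c) = fun _ => 0 := by
  funext y; simp [partialDeriv]

variable [Fintype ι]

theorem analyticAt_partialDeriv (hf : AnalyticAt ℝ f x) (i : ι) :
    AnalyticAt ℝ (partialDeriv i f) x :=
  ((ContinuousLinearMap.apply ℝ ℝ (Pi.single i (1 : ℝ) : ι → ℝ)).analyticAt _).comp hf.fderiv

theorem analyticAt_iteratedPartial (hf : AnalyticAt ℝ f x) (l : List ι) :
    AnalyticAt ℝ (iteratedPartial l f) x := by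
  induction l with
  | nil => exact hf
  | cons i l ih => exact analyticAt_partialDeriv ih i

theorem partialDeriv_comm (hf : AnalyticAt ℝ f x) (i j : ι) :
    partialDeriv i (partialDeriv j f) x = partialDeriv j (partialDeriv i f) x := by
  have key (i j : ι) : partialDeriv i (partialDeriv j f) x =
      fderiv ℝ (fderiv ℝ f) x (Pi.single i 1) (Pi.single j 1) := by
    have h := (hf.fderiv.differentiableAt.hasFDerivAt).clm_apply
      (hasFDerivAt_const (Pi.single j (1 : ℝ) : ι → ℝ) x)
    change fderiv ℝ (fun y => fderiv ℝ f y (Pi.single j 1)) x _ = _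
    rw [h.fderiv]
    simp
  rw [key, key]
  have hs : IsSymmSndFDerivAt ℝ f x :=
    ContDiffAt.isSymmSndFDerivAt (n := ⊤) hf.contDiffAt le_top
  exact hs _ _

/-- Iterated partial derivatives of an analytic function do not depend on the order of the
differentiations. -/
theorem iteratedPartial_perm {l l' : List ι} (h : l.Perm l') :
    ∀ {x : ι → ℝ}, AnalyticAt ℝ f x → iteratedPartial l f x = iteratedPartial l' f x := by
  induction h with
  | nil => exact fun _ => rfl
  | cons i _ ih =>
    intro x hx
    exact (partialDeriv_congr (hx.eventually_analyticAt.mono fun y hy => ih hy) i).self_of_nhds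
  | swap i j l => exact fun hx => partialDeriv_comm (analyticAt_iteratedPartial hx l) j i
  | trans _ _ ih₁ ih₂ => exact fun hx => (ih₁ hx).trans (ih₂ hx)

theorem partialDeriv_const_mul (c : ℝ) (i : ι) (f : (ι → ℝ) → ℝ) :
    partialDeriv i (fun y => c * f y) = fun y => c * partialDeriv i f y := by
  funext y
  change fderiv ℝ (c • f) y _ = _
  rw [fderiv_const_smul_field]; rfl

theorem iteratedPartial_const_mul (c : ℝ) (l : List ι) (f : (ι → ℝ) → ℝ) :
    iteratedPartial l (fun y => c * f y) = fun y => c * iteratedPartial l f y := by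
  induction l with
  | nil => rfl
  | cons i l ih =>
    change partialDeriv i (iteratedPartial l _) = _
    rw [ih, partialDeriv_const_mul]; rfl

theorem partialDeriv_add (hf : AnalyticAt ℝ f x) (hg : AnalyticAt ℝ g x) (i : ι) :
    partialDeriv i (fun y => f y + g y) =ᶠ[𝓝 x]
      fun y => partialDeriv i f y + partialDeriv i g y := by
  filter_upwards [hf.eventually_analyticAt, hg.eventually_analyticAt] with y h₁ h₂
  have h := h₁.differentiableAt.hasFDerivAt.add h₂.differentiableAt.hasFDerivAt
  change fderiv ℝ (f + g) y _ = _
  rw [h.fderiv]; rfl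

theorem partialDeriv_mul (hf : AnalyticAt ℝ f x) (hg : AnalyticAt ℝ g x) (i : ι) :
    partialDeriv i (fun y => f y * g y) =ᶠ[𝓝 x]
      fun y => partialDeriv i f y * g y + f y * partialDeriv i g y := by
  filter_upwards [hf.eventually_analyticAt, hg.eventually_analyticAt] with y h₁ h₂
  have h := h₁.differentiableAt.hasFDerivAt.mul h₂.differentiableAt.hasFDerivAt
  change fderiv ℝ (f * g) y _ = _
  rw [h.fderiv]
  simp [partialDeriv]; ring

theorem partialDeriv_comp {h : ℝ → ℝ} {h' : ℝ} {y : ι → ℝ} (hf : DifferentiableAt ℝ f y)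
    (hh : HasDerivAt h h' (f y)) (i : ι) :
    partialDeriv i (fun z => h (f z)) y = h' * partialDeriv i f y := by
  have := hh.comp_hasFDerivAt y hf.hasFDerivAt
  change fderiv ℝ (h ∘ f) y _ = _
  rw [this.fderiv]; simp [partialDeriv]

theorem partialDeriv_inv (hf : AnalyticAt ℝ f x) (h0 : f x ≠ 0) (i : ι) :
    partialDeriv i (fun y => (f y)⁻¹) =ᶠ[𝓝 x]
      fun y => (-1) * (partialDeriv i f y * ((f y)⁻¹ * (f y)⁻¹)) := by
  filter_upwards [hf.eventually_analyticAt, hf.continuousAt.eventually_ne h0] with y h₁ h₂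
  rw [partialDeriv_comp h₁.differentiableAt (hasDerivAt_inv h₂)]
  field_simp

end Partial

/-! ### Functions with conjugate Taylor expansions -/

section Conjugate

variable {ι : Type} [Fintype ι] [DecidableEq ι] {K : Type} [Field K] [Algebra K ℝ]

/-- The functions `f` and `g` are analytic at `0`, their values there lie in `K`, and the value of
`g` is the conjugate of the value of `f`; and up to order `n` the same holds recursively for the
derivative of `f` along the `i`-th variable and `ε i` times the derivative of `g` along the variable
`e i`. When this holds for all `n`, the Taylor expansion of `g` is the image of the expansion of `f`
under the operator that acts by `σ` on coefficients and sends the `i`-th variable to `ε i` times the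
variable `e i`. -/
def ConjugateJets (σ : K →+* K) (e : Equiv.Perm ι) (ε : ι → ℤˣ) :
    ℕ → ((ι → ℝ) → ℝ) → ((ι → ℝ) → ℝ) → Prop
  | 0, f, g => AnalyticAt ℝ f 0 ∧ AnalyticAt ℝ g 0 ∧
      ∃ a : K, f 0 = algebraMap K ℝ a ∧ g 0 = algebraMap K ℝ (σ a)
  | n + 1, f, g => (AnalyticAt ℝ f 0 ∧ AnalyticAt ℝ g 0 ∧
      ∃ a : K, f 0 = algebraMap K ℝ a ∧ g 0 = algebraMap K ℝ (σ a)) ∧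
      ∀ i, ConjugateJets σ e ε n (partialDeriv i f)
        (fun y => ((ε i : ℤ) : ℝ) * partialDeriv (e i) g y)

namespace ConjugateJets

variable {σ : K →+* K} {e : Equiv.Perm ι} {ε : ι → ℤˣ} {n : ℕ} {f g f₁ g₁ f₂ g₂ : (ι → ℝ) → ℝ}

theorem zero_of (h : ConjugateJets σ e ε n f g) : ConjugateJets σ e ε 0 f g := by
  cases n with
  | zero => exact h
  | succ n => exact h.1

theorem of_succ (h : ConjugateJets σ e ε (n + 1) f g) : ConjugateJets σ e ε n f g := by
  induction n generalizing f g with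
  | zero => exact h.zero_of
  | succ n ih => exact ⟨h.1, fun i => ih (h.2 i)⟩

theorem congr (h : ConjugateJets σ e ε n f g) (hf : f =ᶠ[𝓝 0] f₁) (hg : g =ᶠ[𝓝 0] g₁) :
    ConjugateJets σ e ε n f₁ g₁ := by
  have h0 {f g f₁ g₁ : (ι → ℝ) → ℝ} (h : ConjugateJets σ e ε 0 f g) (hf : f =ᶠ[𝓝 0] f₁)
      (hg : g =ᶠ[𝓝 0] g₁) : ConjugateJets σ e ε 0 f₁ g₁ := by
    obtain ⟨h₁, h₂, a, h₃, h₄⟩ := h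
    exact ⟨h₁.congr hf, h₂.congr hg, a, hf.self_of_nhds ▸ h₃, hg.self_of_nhds ▸ h₄⟩
  induction n generalizing f g f₁ g₁ with
  | zero => exact h0 h hf hg
  | succ n ih =>
    refine ⟨h0 h.1 hf hg, fun i => ih (h.2 i) (partialDeriv_congr hf i) ?_⟩
    exact (partialDeriv_congr hg (e i)).mono fun y hy => by simp only [hy]

theorem zero_const (a : K) : ConjugateJets σ e ε 0 (fun _ => algebraMap K ℝ a)
    (fun _ => algebraMap K ℝ (σ a)) :=
  ⟨analyticAt_const, analyticAt_const, a, rfl, rfl⟩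

theorem const (a : K) (n : ℕ) : ConjugateJets σ e ε n (fun _ => algebraMap K ℝ a)
    (fun _ => algebraMap K ℝ (σ a)) := by
  induction n generalizing a with
  | zero => exact zero_const a
  | succ n ih =>
    refine ⟨zero_const (e := e) (ε := ε) a, fun i => ?_⟩
    simpa [partialDeriv_const] using ih 0

theorem add (h₁ : ConjugateJets σ e ε n f₁ g₁) (h₂ : ConjugateJets σ e ε n f₂ g₂) :
    ConjugateJets σ e ε n (fun y => f₁ y + f₂ y) (fun y => g₁ y + g₂ y) := by
  have h0 : ConjugateJets σ e ε 0 (fun y => f₁ y + f₂ y) (fun y => g₁ y + g₂ y) := by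
    obtain ⟨hf₁, hg₁, a, hfa, hga⟩ := h₁.zero_of
    obtain ⟨hf₂, hg₂, b, hfb, hgb⟩ := h₂.zero_of
    exact ⟨hf₁.add hf₂, hg₁.add hg₂, a + b, by simp [hfa, hfb], by simp [hga, hgb]⟩
  induction n generalizing f₁ g₁ f₂ g₂ with
  | zero => exact h0
  | succ n ih =>
    refine ⟨h0, fun i => (ih (h₁.2 i) (h₂.2 i) ?_).congr
      (partialDeriv_add h₁.1.1 h₂.1.1 i).symm ?_⟩
    · obtain ⟨hf₁, hg₁, a, hfa, hga⟩ := (h₁.2 i).zero_of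
      obtain ⟨hf₂, hg₂, b, hfb, hgb⟩ := (h₂.2 i).zero_of
      exact ⟨hf₁.add hf₂, hg₁.add hg₂, a + b, by simp [hfa, hfb], by simp [hga, hgb]⟩
    · filter_upwards [partialDeriv_add h₁.1.2.1 h₂.1.2.1 (e i)] with y hy
      rw [hy, mul_add]

theorem zero_mul (h₁ : ConjugateJets σ e ε 0 f₁ g₁) (h₂ : ConjugateJets σ e ε 0 f₂ g₂) :
    ConjugateJets σ e ε 0 (fun y => f₁ y * f₂ y) (fun y => g₁ y * g₂ y) := by
  obtain ⟨hf₁, hg₁, a, hfa, hga⟩ := h₁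
  obtain ⟨hf₂, hg₂, b, hfb, hgb⟩ := h₂
  exact ⟨hf₁.mul hf₂, hg₁.mul hg₂, a * b, by simp [hfa, hfb], by simp [hga, hgb]⟩

theorem mul (h₁ : ConjugateJets σ e ε n f₁ g₁) (h₂ : ConjugateJets σ e ε n f₂ g₂) :
    ConjugateJets σ e ε n (fun y => f₁ y * f₂ y) (fun y => g₁ y * g₂ y) := by
  induction n generalizing f₁ g₁ f₂ g₂ with
  | zero => exact zero_mul h₁ h₂
  | succ n ih =>
    refine ⟨zero_mul h₁.zero_of h₂.zero_of, fun i =>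
      ((ih (h₁.2 i) h₂.of_succ).add (ih h₁.of_succ (h₂.2 i))).congr
      (partialDeriv_mul h₁.1.1 h₂.1.1 i).symm ?_⟩
    filter_upwards [partialDeriv_mul h₁.1.2.1 h₂.1.2.1 (e i)] with y hy
    rw [hy]; ring

theorem const_mul (a : K) (h : ConjugateJets σ e ε n f g) :
    ConjugateJets σ e ε n (fun y => algebraMap K ℝ a * f y)
      (fun y => algebraMap K ℝ (σ a) * g y) :=
  (const a n).mul h

theorem int_mul (m : ℤ) (h : ConjugateJets σ e ε n f g) :
    ConjugateJets σ e ε n (fun y => (m : ℝ) * f y) (fun y => (m : ℝ) * g y) := by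
  simpa using const_mul (m : K) h

/-- The induction uses `(1 / f)' = -f' (1 / f)²`. -/
theorem inv (h : ConjugateJets σ e ε n f g) (h0 : f 0 ≠ 0) :
    ConjugateJets σ e ε n (fun y => (f y)⁻¹) (fun y => (g y)⁻¹) := by
  obtain ⟨hf, hg, a, hfa, hga⟩ := h.zero_of
  have hg0 : g 0 ≠ 0 := by
    rw [hfa] at h0
    rw [hga]
    simpa using h0
  have hz : ConjugateJets σ e ε 0 (fun y => (f y)⁻¹) (fun y => (g y)⁻¹) :=
    ⟨hf.inv h0, hg.inv hg0, a⁻¹, by simp [hfa], by simp [hga]⟩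
  induction n with
  | zero => exact hz
  | succ n ih =>
    refine ⟨hz, fun i => ((int_mul (-1) ((h.2 i).mul
      ((ih h.of_succ).mul (ih h.of_succ))))).congr ?_ ?_⟩
    · filter_upwards [partialDeriv_inv hf h0 i] with y hy
      rw [hy]; push_cast; ring
    · filter_upwards [partialDeriv_inv hg hg0 (e i)] with y hy
      rw [hy]; push_cast; ring

/-- The last entry of the list is the derivative taken first, hence the induction from the right. -/
theorem iteratedPartial_eq {l : List ι} (h : ConjugateJets σ e ε l.length f g) :
    ∃ a : K, iteratedPartial l f 0 = algebraMap K ℝ a ∧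
      iteratedPartial (l.map e) g 0 =
        (((l.map ε).prod : ℤ) : ℝ) * algebraMap K ℝ (σ a) := by
  induction l using List.reverseRecOn generalizing f g with
  | nil =>
    obtain ⟨-, -, a, h₁, h₂⟩ := h
    exact ⟨a, h₁, by simpa [iteratedPartial] using h₂⟩
  | append_singleton l i ih =>
    rw [List.length_append, List.length_singleton] at h
    obtain ⟨a, h₁, h₂⟩ := ih (h.2 i)
    refine ⟨a, by rwa [iteratedPartial_concat], ?_⟩
    rw [iteratedPartial_const_mul] at h₂
    have hu : ((ε i : ℤ) : ℝ) * ((ε i : ℤ) : ℝ) = 1 := by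
      rw [← Int.cast_mul, ← Units.val_mul, Int.units_mul_self]; simp
    simp only [List.map_append, List.map_singleton, List.prod_append, List.prod_singleton,
      iteratedPartial_concat, Units.val_mul, Int.cast_mul]
    linear_combination ((ε i : ℤ) : ℝ) * h₂ -
      iteratedPartial (l.map e) (partialDeriv (e i) g) 0 * hu

/-- The Taylor coefficients of functions with conjugate jets lie in `K` and are conjugate up to the
sign of the monomial. -/
theorem taylorCoeff_eq (h : ∀ n, ConjugateJets σ e ε n f g) (n : ι →₀ ℕ) :
    ∃ a : K, taylorCoeff f n = algebraMap K ℝ a ∧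
      taylorCoeff g (n.mapDomain e) =
        (((∏ i, ε i ^ n i : ℤˣ) : ℤ) : ℝ) * algebraMap K ℝ (σ a) := by
  obtain ⟨a, h₁, h₂⟩ := (h (Finsupp.toMultiset n).toList.length).iteratedPartial_eq
  refine ⟨a / ∏ i, ((n i).factorial : K), by simp [taylorCoeff, h₁], ?_⟩
  have hperm : (Finsupp.toMultiset (n.mapDomain e)).toList.Perm
      ((Finsupp.toMultiset n).toList.map e) := by
    rw [← Multiset.coe_eq_coe, ← Multiset.map_coe, Multiset.coe_toList, Multiset.coe_toList,
      Finsupp.toMultiset_map]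
  have hprod : ((Finsupp.toMultiset n).toList.map ε).prod = ∏ i, ε i ^ n i := by
    rw [← Multiset.prod_coe, ← Multiset.map_coe, Multiset.coe_toList, Finsupp.toMultiset_map,
      Finsupp.prod_toMultiset, Finsupp.prod_mapDomain_index (by simp) (by simp [pow_add]),
      Finsupp.prod_fintype _ _ (by simp)]
  rw [taylorCoeff, iteratedPartial_perm hperm (h 0).2.1, h₂, hprod,
    ← Equiv.prod_comp e fun i => ((n.mapDomain e i).factorial : ℝ)]
  simp only [Finsupp.mapDomain_apply e.injective]
  simp [mul_div_assoc]

end ConjugateJets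

theorem coeff_taylorPart (f : (ι → ℝ) → ℝ) (k : ℕ) (n : ι →₀ ℕ) :
    (taylorPart k f).coeff n = if ∑ i, n i = k then taylorCoeff f n else 0 := by
  simp [taylorPart, MvPolynomial.coeff_sum, MvPolynomial.coeff_monomial,
    Finset.mem_finsuppAntidiag]

theorem exists_map_eq_taylorPart (f : (ι → ℝ) → ℝ)
    (h : ∀ n, ∃ a : K, taylorCoeff f n = algebraMap K ℝ a) (k : ℕ) :
    ∃ P : MvPolynomial ι K, MvPolynomial.map (algebraMap K ℝ) P = taylorPart k f := by
  choose a ha using h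
  refine ⟨∑ n ∈ Finset.finsuppAntidiag Finset.univ k, MvPolynomial.monomial n (a n), ?_⟩
  simp [taylorPart, ha]

end Conjugate

/-- A signed permutation operator maps the homogeneous parts of the expansion of `f` to those of
`g`, when `f` and `g` have conjugate jets of all orders. -/
theorem signedPerm_eq_of_conjugateJets {K : Type} [Field K] [Algebra K ℝ] {σ : K ≃+* K}
    {π : Equiv.Perm Label} {ε : Coord → ℤˣ} {f g : (Label × Coord → ℝ) → ℝ}
    (h : ∀ n, ConjugateJets (σ : K →+* K) (π.prodCongr (Equiv.refl Coord)) (fun i => ε i.2) n f g)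
    {k : ℕ} {P Q : Forms K} (hP : MvPolynomial.map (algebraMap K ℝ) P = taylorPart k f)
    (hQ : MvPolynomial.map (algebraMap K ℝ) Q = taylorPart k g) :
    signedPerm σ π ε P = Q := by
  ext m
  obtain ⟨n, rfl⟩ : ∃ n : Label × Coord →₀ ℕ, n.mapDomain (π.prodCongr (Equiv.refl Coord)) = m :=
    (Finsupp.mapDomain_surjective (Equiv.surjective _)) m
  rw [coeff_signedPerm]
  have h₁ := congrArg (MvPolynomial.coeff n) hP
  have h₂ := congrArg (MvPolynomial.coeff (n.mapDomain (π.prodCongr (Equiv.refl Coord)))) hQ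
  rw [MvPolynomial.coeff_map, coeff_taylorPart] at h₁ h₂
  rw [← (π.prodCongr (Equiv.refl Coord)).sum_comp] at h₂
  simp only [Finsupp.mapDomain_apply (Equiv.injective _)] at h₂
  obtain ⟨a, ha, hb⟩ := ConjugateJets.taylorCoeff_eq h n
  apply (algebraMap K ℝ).injective
  rw [h₂]
  split_ifs at h₁ ⊢ with hk
  · have : P.coeff n = a := (algebraMap K ℝ).injective (h₁.trans ha)
    rw [hb, this]; simp
  · have : P.coeff n = 0 := by simpa using h₁
    simp [this]

/-! ### The distance between two tangent lines -/

/-- The distance of two skew lines: the component of the vector between two of their points along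
the cross product `m` of the directions. -/
theorem lineDist_sq (p u q v : Space) (m : Fin 3 → ℝ) (h0 : m 0 = u 1 * v 2 - u 2 * v 1)
    (h1 : m 1 = u 2 * v 0 - u 0 * v 2) (h2 : m 2 = u 0 * v 1 - u 1 * v 0)
    (hm : m 0 ^ 2 + m 1 ^ 2 + m 2 ^ 2 ≠ 0) :
    lineDist (Set.range fun s : ℝ => p + s • u) (Set.range fun t : ℝ => q + t • v) ^ 2 =
      ((p 0 - q 0) * m 0 + (p 1 - q 1) * m 1 + (p 2 - q 2) * m 2) ^ 2 /
        (m 0 ^ 2 + m 1 ^ 2 + m 2 ^ 2) := by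
  set D := m 0 ^ 2 + m 1 ^ 2 + m 2 ^ 2 with hD
  set N := (p 0 - q 0) * m 0 + (p 1 - q 1) * m 1 + (p 2 - q 2) * m 2 with hN
  have hDpos : 0 < D := lt_of_le_of_ne (by positivity) (Ne.symm hm)
  have hdist (s t : ℝ) : dist (p + s • u) (q + t • v) =
      √((p 0 + s * u 0 - (q 0 + t * v 0)) ^ 2 + (p 1 + s * u 1 - (q 1 + t * v 1)) ^ 2 +
        (p 2 + s * u 2 - (q 2 + t * v 2)) ^ 2) := by
    rw [EuclideanSpace.dist_eq, Fin.sum_univ_three]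
    simp [Real.dist_eq, sq_abs]
  have hleast : IsLeast (Set.image2 dist (Set.range fun s : ℝ => p + s • u)
      (Set.range fun t : ℝ => q + t • v)) (√(N ^ 2 / D)) := by
    constructor
    · -- the feet of the common perpendicular, by Cramer's rule
      refine ⟨_, ⟨-((v 1 * m 2 - v 2 * m 1) * (p 0 - q 0) + (v 2 * m 0 - v 0 * m 2) * (p 1 - q 1) +
          (v 0 * m 1 - v 1 * m 0) * (p 2 - q 2)) / D, rfl⟩, _,
        ⟨((m 1 * u 2 - m 2 * u 1) * (p 0 - q 0) + (m 2 * u 0 - m 0 * u 2) * (p 1 - q 1) +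
          (m 0 * u 1 - m 1 * u 0) * (p 2 - q 2)) / D, rfl⟩, ?_⟩
      simp only [hdist]
      congr 1
      have hw (i : Fin 3) : p i + -((v 1 * m 2 - v 2 * m 1) * (p 0 - q 0) +
          (v 2 * m 0 - v 0 * m 2) * (p 1 - q 1) + (v 0 * m 1 - v 1 * m 0) * (p 2 - q 2)) / D * u i -
          (q i + ((m 1 * u 2 - m 2 * u 1) * (p 0 - q 0) + (m 2 * u 0 - m 0 * u 2) * (p 1 - q 1) +
          (m 0 * u 1 - m 1 * u 0) * (p 2 - q 2)) / D * v i) = N * m i / D := by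
        have hD0 : D ≠ 0 := hm
        field_simp
        rw [hN, hD]
        fin_cases i <;> simp only [Fin.zero_eta, Fin.mk_one, Fin.reduceFinMk] <;>
          rw [h0, h1, h2] <;> ring
      rw [hw, hw, hw]
      field_simp
      rw [hD]
    · rintro _ ⟨_, ⟨s, rfl⟩, _, ⟨t, rfl⟩, rfl⟩
      simp only [hdist]
      apply Real.sqrt_le_sqrt
      set w0 := p 0 + s * u 0 - (q 0 + t * v 0) with hw0
      set w1 := p 1 + s * u 1 - (q 1 + t * v 1) with hw1
      set w2 := p 2 + s * u 2 - (q 2 + t * v 2) with hw2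
      have hNw : N = w0 * m 0 + w1 * m 1 + w2 * m 2 := by
        rw [hN, hw0, hw1, hw2, h0, h1, h2]; ring
      rw [div_le_iff₀ hDpos, hNw, hD]
      have hlag : (w0 ^ 2 + w1 ^ 2 + w2 ^ 2) * (m 0 ^ 2 + m 1 ^ 2 + m 2 ^ 2) -
          (w0 * m 0 + w1 * m 1 + w2 * m 2) ^ 2 = (w0 * m 1 - w1 * m 0) ^ 2 +
          (w0 * m 2 - w2 * m 0) ^ 2 + (w1 * m 2 - w2 * m 1) ^ 2 := by ring
      exact sub_nonneg.1 (hlag ▸ by positivity)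
  rw [lineDist, hleast.csInf_eq, Real.sq_sqrt (by positivity)]

/-- The scalar product of the directions of two tangent lines, divided by the product of the cosines
of their inclinations; `s`, `c`, `T` stand for the sines and cosines of the latitudes and for the
tangents of the inclinations, `C` and `S` for the cosine and the sine of the difference of the
longitudes. -/
def dotNum (s₁ c₁ T₁ s₂ c₂ T₂ C S : ℝ) : ℝ :=
  s₁ * s₂ * C + c₁ * c₂ + (T₁ * s₂ - T₂ * s₁) * S + T₁ * T₂ * C

/-- The mixed product of two tangent lines (the numerator of their distance), divided by the product
of the cosines of their inclinations, in the notation of `dotNum`. -/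
def detNum (s₁ c₁ T₁ s₂ c₂ T₂ C S : ℝ) : ℝ :=
  (s₁ - s₂) * (1 - T₁ * T₂) * S + (T₁ + T₂) * (c₁ * c₂ + s₁ * s₂ * C - C)

open Real in
theorem norm_direction (φ l δ : ℝ) :
    direction φ l δ 0 ^ 2 + direction φ l δ 1 ^ 2 + direction φ l δ 2 ^ 2 = 1 := by
  simp [direction, northVec, eastVec]
  linear_combination (cos δ ^ 2 * sin φ ^ 2 + sin δ ^ 2) * sin_sq_add_cos_sq l +
    cos δ ^ 2 * sin_sq_add_cos_sq φ + sin_sq_add_cos_sq δ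

open Real in
/-- The moment of a tangent line is its direction turned by a right angle in the tangent plane. -/
theorem spherePoint_cross_direction (φ l δ : ℝ) :
    let p := spherePoint φ l
    let u := direction φ l δ
    let w := - (cos δ • eastVec l + sin δ • northVec φ l)
    p 1 * u 2 - p 2 * u 1 = w 0 ∧ p 2 * u 0 - p 0 * u 2 = w 1 ∧ p 0 * u 1 - p 1 * u 0 = w 2 := by
  refine ⟨?_, ?_, ?_⟩ <;> simp [spherePoint, direction, northVec, eastVec]
  · linear_combination cos δ * sin l * sin_sq_add_cos_sq φ
  · linear_combination -(cos δ * cos l) * sin_sq_add_cos_sq φ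
  · linear_combination -(sin δ * cos φ) * sin_sq_add_cos_sq l

open Real in
theorem lineDist_tangentLine_sq {φ₁ l₁ δ₁ φ₂ l₂ δ₂ : ℝ} (h₁ : cos δ₁ ≠ 0) (h₂ : cos δ₂ ≠ 0)
    (hW : (1 + tan δ₁ ^ 2) * (1 + tan δ₂ ^ 2) - dotNum (sin φ₁) (cos φ₁) (tan δ₁) (sin φ₂) (cos φ₂)
      (tan δ₂) (cos (l₂ - l₁)) (sin (l₂ - l₁)) ^ 2 ≠ 0) :
    lineDist (tangentLine φ₁ l₁ δ₁) (tangentLine φ₂ l₂ δ₂) ^ 2 =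
      detNum (sin φ₁) (cos φ₁) (tan δ₁) (sin φ₂) (cos φ₂) (tan δ₂) (cos (l₂ - l₁))
        (sin (l₂ - l₁)) ^ 2 /
      ((1 + tan δ₁ ^ 2) * (1 + tan δ₂ ^ 2) - dotNum (sin φ₁) (cos φ₁) (tan δ₁) (sin φ₂) (cos φ₂)
        (tan δ₂) (cos (l₂ - l₁)) (sin (l₂ - l₁)) ^ 2) := by
  set u := direction φ₁ l₁ δ₁ with hu
  set v := direction φ₂ l₂ δ₂ with hv
  set p := spherePoint φ₁ l₁ with hp
  set q := spherePoint φ₂ l₂ with hq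
  set a := dotNum (sin φ₁) (cos φ₁) (tan δ₁) (sin φ₂) (cos φ₂) (tan δ₂) (cos (l₂ - l₁))
    (sin (l₂ - l₁)) with ha
  set b := detNum (sin φ₁) (cos φ₁) (tan δ₁) (sin φ₂) (cos φ₂) (tan δ₂) (cos (l₂ - l₁))
    (sin (l₂ - l₁)) with hb
  have huv : u 0 * v 0 + u 1 * v 1 + u 2 * v 2 = cos δ₁ * cos δ₂ * a := by
    rw [ha, dotNum, tan_eq_sin_div_cos, tan_eq_sin_div_cos, cos_sub, sin_sub]
    simp [hu, hv, direction, northVec, eastVec]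
    field_simp
    ring
  have huu : u 0 ^ 2 + u 1 ^ 2 + u 2 ^ 2 = 1 := norm_direction _ _ _
  have hvv : v 0 ^ 2 + v 1 ^ 2 + v 2 ^ 2 = 1 := norm_direction _ _ _
  set m : Fin 3 → ℝ := ![u 1 * v 2 - u 2 * v 1, u 2 * v 0 - u 0 * v 2, u 0 * v 1 - u 1 * v 0] with hm
  have hdet : (p 0 - q 0) * m 0 + (p 1 - q 1) * m 1 + (p 2 - q 2) * m 2 =
      - (cos δ₁ * cos δ₂ * b) := by
    rw [hb, detNum, tan_eq_sin_div_cos, tan_eq_sin_div_cos, cos_sub, sin_sub]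
    obtain ⟨x₀, x₁, x₂⟩ := spherePoint_cross_direction φ₁ l₁ δ₁
    obtain ⟨y₀, y₁, y₂⟩ := spherePoint_cross_direction φ₂ l₂ δ₂
    rw [← hp, ← hu] at x₀ x₁ x₂
    rw [← hq, ← hv] at y₀ y₁ y₂
    have : (p 0 - q 0) * m 0 + (p 1 - q 1) * m 1 + (p 2 - q 2) * m 2 =
        (p 1 * u 2 - p 2 * u 1) * v 0 + (p 2 * u 0 - p 0 * u 2) * v 1 +
          (p 0 * u 1 - p 1 * u 0) * v 2 + ((q 1 * v 2 - q 2 * v 1) * u 0 +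
          (q 2 * v 0 - q 0 * v 2) * u 1 + (q 0 * v 1 - q 1 * v 0) * u 2) := by
      simp [hm]; ring
    rw [this, x₀, x₁, x₂, y₀, y₁, y₂]
    simp [hu, hv, direction, northVec, eastVec]
    field_simp
    ring
  have hmm : m 0 ^ 2 + m 1 ^ 2 + m 2 ^ 2 = (cos δ₁ * cos δ₂) ^ 2 *
      ((1 + tan δ₁ ^ 2) * (1 + tan δ₂ ^ 2) - a ^ 2) := by
    have e₁ : cos δ₁ ^ 2 * (1 + tan δ₁ ^ 2) = 1 := by
      rw [mul_comm, ← inv_inj, mul_inv, inv_one, inv_one_add_tan_sq h₁]; field_simp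
    have e₂ : cos δ₂ ^ 2 * (1 + tan δ₂ ^ 2) = 1 := by
      rw [mul_comm, ← inv_inj, mul_inv, inv_one, inv_one_add_tan_sq h₂]; field_simp
    have : m 0 ^ 2 + m 1 ^ 2 + m 2 ^ 2 = (u 0 ^ 2 + u 1 ^ 2 + u 2 ^ 2) *
        (v 0 ^ 2 + v 1 ^ 2 + v 2 ^ 2) - (u 0 * v 0 + u 1 * v 1 + u 2 * v 2) ^ 2 := by
      simp [hm]; ring
    rw [this, huu, hvv, huv]
    linear_combination (-1 : ℝ) * (cos δ₂ ^ 2 * (1 + tan δ₂ ^ 2)) * e₁ - e₂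
  have hcc : cos δ₁ * cos δ₂ ≠ 0 := mul_ne_zero h₁ h₂
  rw [tangentLine, tangentLine, lineDist_sq p u q v m rfl rfl rfl
    (by rw [hmm]; exact mul_ne_zero (pow_ne_zero 2 hcc) hW), hdet, hmm, neg_sq, mul_pow,
    mul_div_mul_left _ _ (pow_ne_zero 2 hcc)]

/-! ### The angles of the configuration -/

section Base

open Real

variable {x : ℝ}

theorem pX_sq (h0 : 0 < x) : pX x ^ 2 = (1 + x) * (1 + 3 * x) / 3 :=
  sq_sqrt (by positivity)

theorem pX_pos (h0 : 0 < x) : 0 < pX x := sqrt_pos.2 (by positivity)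

theorem sqrt_three_mul_pX (x : ℝ) : √3 * pX x = √((1 + x) * (1 + 3 * x)) := by
  rw [pX, ← sqrt_mul (by norm_num)]; congr 1; ring

theorem sin_phi_eq (h0 : 0 < x) (h1 : x < 1) : sin (baseAngle x phi) =
    2 * √((1 - x) * x * (1 + x) / (1 + 7 * x + 4 * x ^ 2)) := by
  have h : 0 ≤ (1 - x) * x * (1 + x) / (1 + 7 * x + 4 * x ^ 2) := by
    have := sub_pos.2 h1; positivity
  refine sin_arcsin (by linarith [sqrt_nonneg ((1 - x) * x * (1 + x) / (1 + 7 * x + 4 * x ^ 2))]) ?_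
  rw [← sq_le_one_iff₀ (by positivity), mul_pow, sq_sqrt h, ← mul_div_assoc,
    div_le_one (by positivity)]
  nlinarith [pow_pos h0 3]

theorem sin_phi_sq (h0 : 0 < x) (h1 : x < 1) : sin (baseAngle x phi) ^ 2 =
    4 * ((1 - x) * x * (1 + x)) / (1 + 7 * x + 4 * x ^ 2) := by
  have h : 0 ≤ (1 - x) * x * (1 + x) / (1 + 7 * x + 4 * x ^ 2) := by
    have := sub_pos.2 h1; positivity
  rw [sin_phi_eq h0 h1, mul_pow, sq_sqrt h]; ring

theorem sin_phi_pos (h0 : 0 < x) (h1 : x < 1) : 0 < sin (baseAngle x phi) := by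
  rw [sin_phi_eq h0 h1]
  have := sub_pos.2 h1
  positivity

theorem cos_phi_pos (h0 : 0 < x) (h1 : x < 1) : 0 < cos (baseAngle x phi) := by
  have hs := sin_phi_sq h0 h1
  have h2 : cos (baseAngle x phi) ^ 2 = (1 + 3 * x + 4 * x ^ 2 + 4 * x ^ 3) /
      (1 + 7 * x + 4 * x ^ 2) := by
    rw [cos_sq', hs]; field_simp; ring
  have h3 : 0 ≤ cos (baseAngle x phi) := cos_arcsin_nonneg _
  refine lt_of_le_of_ne h3 fun h => ?_
  rw [← h] at h2
  have : 0 < (1 + 3 * x + 4 * x ^ 2 + 4 * x ^ 3) / (1 + 7 * x + 4 * x ^ 2) := by positivity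
  rw [← h2] at this
  norm_num at this

theorem tan_delta_pos (h0 : 0 < x) (h1 : x < 1) : 0 < tan (baseAngle x delta) := by
  rw [baseAngle, tan_arctan]
  have := sub_pos.2 h1
  positivity

theorem tan_delta_sq (h0 : 0 < x) (h1 : x < 1) : tan (baseAngle x delta) ^ 2 =
    (1 - x) * (1 + 3 * x) / (x * (1 + 7 * x + 4 * x ^ 2)) := by
  have := sub_pos.2 h1
  rw [baseAngle, tan_arctan, sq_sqrt (by positivity)]

theorem cos_delta_pos (x : ℝ) : 0 < cos (baseAngle x delta) := cos_arctan_pos _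

/-- Although the sine of the latitude and the tangent of the inclination are only square roots of
rational functions of `x`, their product is a rational multiple of `√3 * pX x`. -/
theorem sqrt_three_mul_tan_mul_sin (h0 : 0 < x) (h1 : x < 1) :
    √3 * (tan (baseAngle x delta) * sin (baseAngle x phi)) =
      6 * (1 - x) / (1 + 7 * x + 4 * x ^ 2) * pX x := by
  have hx := sub_pos.2 h1
  have hT := tan_delta_pos h0 h1
  have hs := sin_phi_pos h0 h1
  have hp := pX_pos h0
  rw [← pow_left_inj₀ (by positivity) (by positivity) two_ne_zero, mul_pow, mul_pow, mul_pow,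
    tan_delta_sq h0 h1, sin_phi_sq h0 h1, pX_sq h0, sq_sqrt (by norm_num)]
  field_simp
  ring

theorem tan_kappa_sq (h0 : 0 < x) : tan (baseAngle x kappa) ^ 2 =
    (x - 1) ^ 2 / ((1 + x) * (1 + 3 * x)) := by
  rw [baseAngle, tan_arctan, div_pow, sq_sqrt (by positivity)]

theorem cos_kappa_sq (h0 : 0 < x) : cos (baseAngle x kappa) ^ 2 =
    (1 + x) * (1 + 3 * x) / (2 * (1 + x + 2 * x ^ 2)) := by
  have h : cos (baseAngle x kappa) ≠ 0 := (cos_arctan_pos _).ne'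
  rw [← inv_one_add_tan_sq h, tan_kappa_sq h0, inv_eq_one_div,
    div_eq_div_iff (by positivity) (by positivity)]
  field_simp
  ring

theorem cos_two_kappa (h0 : 0 < x) : cos (2 * baseAngle x kappa) =
    x * (3 + x) / (1 + x + 2 * x ^ 2) := by
  rw [cos_two_mul, cos_kappa_sq h0]
  field_simp
  ring

theorem sqrt_three_mul_sin_two_kappa (h0 : 0 < x) : √3 * sin (2 * baseAngle x kappa) =
    3 * (x - 1) / (1 + x + 2 * x ^ 2) * pX x := by
  have h : cos (baseAngle x kappa) ≠ 0 := (cos_arctan_pos _).ne'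
  have ht : √3 * pX x * tan (baseAngle x kappa) = x - 1 := by
    rw [baseAngle, tan_arctan, sqrt_three_mul_pX]
    have : √((1 + x) * (1 + 3 * x)) ≠ 0 := (sqrt_pos.2 (by positivity)).ne'
    field_simp
  have hs : sin (2 * baseAngle x kappa) =
      2 * tan (baseAngle x kappa) * cos (baseAngle x kappa) ^ 2 := by
    rw [sin_two_mul, tan_eq_sin_div_cos]; field_simp
  rw [hs, cos_kappa_sq h0]
  have hp2 := pX_sq h0
  field_simp at hp2 ⊢
  linear_combination 3 * pX x * ht - √3 * tan (baseAngle x kappa) * hp2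

end Base

/-! ### Differential equations over the field of coefficients -/

section ODE

variable {ι : Type} [Fintype ι]

theorem hasFDerivAt_affine (c : ℝ) (m : ι → ℝ) (y : ι → ℝ) :
    HasFDerivAt (fun y : ι → ℝ => c + ∑ i, m i * y i)
      (∑ i, m i • ContinuousLinearMap.proj (R := ℝ) (φ := fun _ : ι => ℝ) i) y := by
  refine HasFDerivAt.const_add c (HasFDerivAt.fun_sum fun i _ => ?_)
  exact (hasFDerivAt_apply i y).const_mul (m i)

theorem analyticAt_affine (c : ℝ) (m : ι → ℝ) (y : ι → ℝ) :
    AnalyticAt ℝ (fun y : ι → ℝ => c + ∑ i, m i * y i) y := by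
  refine analyticAt_const.add (Finset.analyticAt_fun_sum _ fun i _ => ?_)
  exact analyticAt_const.mul ((ContinuousLinearMap.proj (R := ℝ) (φ := fun _ : ι => ℝ) i).analyticAt y)

variable [DecidableEq ι] {K : Type} [Field K] [Algebra K ℝ]
  {σ : K →+* K} {e : Equiv.Perm ι} {ε : ι → ℤˣ} {n : ℕ} {f g f₁ g₁ f₂ g₂ : (ι → ℝ) → ℝ}

theorem ConjugateJets.sub (h₁ : ConjugateJets σ e ε n f₁ g₁) (h₂ : ConjugateJets σ e ε n f₂ g₂) :
    ConjugateJets σ e ε n (fun y => f₁ y - f₂ y) (fun y => g₁ y - g₂ y) := by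
  simpa [← sub_eq_add_neg] using h₁.add (h₂.int_mul (-1))

theorem ConjugateJets.rat (q : ℚ) (n : ℕ) :
    ConjugateJets σ e ε n (fun _ => (q : ℝ)) (fun _ => (q : ℝ)) := by
  simpa using ConjugateJets.const (σ := σ) (e := e) (ε := ε) (q : K) n

theorem partialDeriv_affine (c : ℝ) (m : ι → ℝ) (i : ι) (y : ι → ℝ) :
    partialDeriv i (fun y : ι → ℝ => c + ∑ i, m i * y i) y = m i := by
  rw [partialDeriv, (hasFDerivAt_affine c m y).fderiv]
  simp [Pi.single_apply]

theorem units_cast_mul_self (u : ℤˣ) : ((u : ℤ) : ℝ) * ((u : ℤ) : ℝ) = 1 := by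
  rw [← Int.cast_mul, ← Units.val_mul, Int.units_mul_self]; simp

open Real in
/-- Multiples `α cos`, `β sin` of the cosine and the sine of an affine function satisfy a linear
system of differential equations, with coefficients `α mᵢ / β` and `β mᵢ / α`. When these are
rational, it is enough to compare the values at the origin. -/
theorem conjugateJets_cos_sin {α β c c' : ℝ} {m m' : ι → ℝ} (τ : ℤˣ)
    (hm : ∀ i, m' (e i) = (τ : ℤ) * (ε i : ℤ) * m i)
    (hα : ∀ i, ∃ q : ℚ, α * m i = q * β) (hβ : ∀ i, ∃ q : ℚ, β * m i = q * α)
    (hcos : ∃ a : K, α * cos c = algebraMap K ℝ a ∧ α * cos c' = algebraMap K ℝ (σ a))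
    (hsin : ∃ a : K, β * sin c = algebraMap K ℝ a ∧
      (τ : ℤ) * (β * sin c') = algebraMap K ℝ (σ a)) (n : ℕ) :
    ConjugateJets σ e ε n (fun y => α * cos (c + ∑ i, m i * y i))
        (fun y => α * cos (c' + ∑ i, m' i * y i)) ∧
      ConjugateJets σ e ε n (fun y => β * sin (c + ∑ i, m i * y i))
        (fun y => (τ : ℤ) * (β * sin (c' + ∑ i, m' i * y i))) := by
  have hc0 : ConjugateJets σ e ε 0 (fun y => α * cos (c + ∑ i, m i * y i))
      (fun y => α * cos (c' + ∑ i, m' i * y i)) :=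
    ⟨analyticAt_const.mul (analyticAt_cos.comp (analyticAt_affine c m 0)),
      analyticAt_const.mul (analyticAt_cos.comp (analyticAt_affine c' m' 0)), by simpa using hcos⟩
  have hs0 : ConjugateJets σ e ε 0 (fun y => β * sin (c + ∑ i, m i * y i))
      (fun y => (τ : ℤ) * (β * sin (c' + ∑ i, m' i * y i))) :=
    ⟨analyticAt_const.mul (analyticAt_sin.comp (analyticAt_affine c m 0)),
      analyticAt_const.mul (analyticAt_const.mul
        (analyticAt_sin.comp (analyticAt_affine c' m' 0))), by simpa using hsin⟩
  have hdc (c : ℝ) (m : ι → ℝ) (i : ι) : partialDeriv i (fun y => cos (c + ∑ i, m i * y i)) =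
      fun y => -sin (c + ∑ i, m i * y i) * m i := by
    funext y
    rw [partialDeriv_comp (hasFDerivAt_affine c m y).differentiableAt (hasDerivAt_cos _),
      partialDeriv_affine]
  have hds (c : ℝ) (m : ι → ℝ) (i : ι) : partialDeriv i (fun y => sin (c + ∑ i, m i * y i)) =
      fun y => cos (c + ∑ i, m i * y i) * m i := by
    funext y
    rw [partialDeriv_comp (hasFDerivAt_affine c m y).differentiableAt (hasDerivAt_sin _),
      partialDeriv_affine]
  have hτ := units_cast_mul_self τ
  induction n with
  | zero => exact ⟨hc0, hs0⟩
  | succ n ih =>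
    refine ⟨⟨hc0, fun i => ?_⟩, ⟨hs0, fun i => ?_⟩⟩
    · obtain ⟨q, hq⟩ := hα i
      have hε := units_cast_mul_self (ε i)
      refine ((ConjugateJets.rat (-q) n).mul ih.2).congr (.of_forall fun y => ?_)
        (.of_forall fun y => ?_)
      · simp only [partialDeriv_const_mul, hdc]
        push_cast
        linear_combination (sin (c + ∑ i, m i * y i)) * hq
      · simp only [partialDeriv_const_mul, hdc, hm]
        push_cast
        linear_combination ((τ : ℤ) : ℝ) * sin (c' + ∑ i, m' i * y i) * (hq + α * m i * hε)
    · obtain ⟨q, hq⟩ := hβ i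
      have hε := units_cast_mul_self (ε i)
      refine ((ConjugateJets.rat q n).mul ih.1).congr (.of_forall fun y => ?_)
        (.of_forall fun y => ?_)
      · simp only [partialDeriv_const_mul, hds]
        linear_combination -(cos (c + ∑ i, m i * y i)) * hq
      · simp only [partialDeriv_const_mul, hds, hm]
        linear_combination -(cos (c' + ∑ i, m' i * y i)) *
          (hq + β * m i * hε * ((τ : ℤ) : ℝ) ^ 2 + β * m i * hτ)

open Real in
/-- If `T = tan d` has a rational square, then `tan (d + T p y) / T` satisfies the Riccati equation
`f' = p (1 + T² f²)`. -/
theorem conjugateJets_tan {T d p : ℝ} (hT : T ≠ 0) (hd : tan d = T) (hcos : cos d ≠ 0) {q : ℚ}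
    (hq : T ^ 2 = q) {j : ι}
    (hp : ∀ n, ConjugateJets σ e ε n (fun _ => p) (fun _ => (ε j : ℤ) * p)) (n : ℕ) :
    ConjugateJets σ e ε n (fun y => T⁻¹ * tan (d + T * p * y j))
      (fun y => T⁻¹ * tan (d + T * p * y (e j))) := by
  have haff (j : ι) (y : ι → ℝ) : HasFDerivAt (fun y : ι → ℝ => d + T * p * y j)
      ((T * p) • ContinuousLinearMap.proj (R := ℝ) (φ := fun _ : ι => ℝ) j) y :=
    ((hasFDerivAt_apply j y).const_mul (T * p)).const_add d
  have han (j : ι) : AnalyticAt ℝ (fun y : ι → ℝ => d + T * p * y j) 0 :=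
    analyticAt_const.add (analyticAt_const.mul
      ((ContinuousLinearMap.proj (R := ℝ) (φ := fun _ : ι => ℝ) j).analyticAt 0))
  have hcos' (j : ι) : cos (d + T * p * (0 : ι → ℝ) j) ≠ 0 := by simpa
  have hantan (j : ι) : AnalyticAt ℝ (fun y : ι → ℝ => T⁻¹ * tan (d + T * p * y j)) 0 := by
    simp only [tan_eq_sin_div_cos]
    exact analyticAt_const.mul ((analyticAt_sin.comp (han j)).div (analyticAt_cos.comp (han j))
      (hcos' j))
  have h0 : ConjugateJets σ e ε 0 (fun y => T⁻¹ * tan (d + T * p * y j))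
      (fun y => T⁻¹ * tan (d + T * p * y (e j))) :=
    ⟨hantan j, hantan (e j), 1, by simp [hd, hT], by simp [hd, hT]⟩
  have hder (j i : ι) : partialDeriv i (fun y : ι → ℝ => T⁻¹ * tan (d + T * p * y j)) =ᶠ[𝓝 0]
      fun y => if i = j then p * (1 + q * ((T⁻¹ * tan (d + T * p * y j)) *
        (T⁻¹ * tan (d + T * p * y j)))) else 0 := by
    have hc : ContinuousAt (fun y : ι → ℝ => cos (d + T * p * y j)) 0 :=
      (analyticAt_cos.comp (han j)).continuousAt
    filter_upwards [hc.eventually_ne (hcos' j)] with y hy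
    rw [partialDeriv_const_mul]
    simp only
    rw [partialDeriv_comp (haff j y).differentiableAt (hasDerivAt_tan hy), partialDeriv,
      (haff j y).fderiv, ← inv_one_add_tan_sq hy, one_div, inv_inv, ← hq]
    have hsingle : (Pi.single i (1 : ℝ) : ι → ℝ) j = if i = j then 1 else 0 := by
      simp [Pi.single_apply, eq_comm]
    simp only [smul_apply, ContinuousLinearMap.proj_apply, hsingle, smul_eq_mul]
    split_ifs
    · field_simp
    · simp
  induction n with
  | zero => exact h0
  | succ n ih =>
    refine ⟨h0, fun i => ?_⟩
    by_cases hij : i = j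
    · subst hij
      refine ((hp n).mul ((ConjugateJets.rat 1 n).add
        ((ConjugateJets.rat q n).mul (ih.mul ih)))).congr ?_ ?_
      · filter_upwards [hder i i] with y hy
        rw [hy]; simp
      · filter_upwards [hder (e i) (e i)] with y hy
        rw [hy]; simp [mul_assoc]
    · refine (ConjugateJets.rat 0 n).congr ?_ ?_
      · filter_upwards [hder j i] with y hy
        rw [hy]; simp [hij]
      · filter_upwards [hder (e j) (e i)] with y hy
        rw [hy]; simp [hij]

end ODE

/-! ### The squared distance as a rational expression -/

/-- `dotNum` for arguments from which their values in the configuration have been divided out: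
`a`, `b`, `t` are the squares of the divisors of `s`, `c`, `T`, and `r` is the product of the
divisors of `s`, `T` and `S`. -/
def normDot (a b t r s₁ c₁ T₁ s₂ c₂ T₂ C S : ℝ) : ℝ :=
  a * (s₁ * s₂ * C) + b * (c₁ * c₂) + r * ((T₁ * s₂ - T₂ * s₁) * S) + t * (T₁ * T₂ * C)

/-- `detNum`, multiplied by the divisor of `T`, in the notation of `normDot`. -/
def normDet (a b t r s₁ c₁ T₁ s₂ c₂ T₂ C S : ℝ) : ℝ :=
  r * ((s₁ - s₂) * (1 - t * (T₁ * T₂)) * S) +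
    t * ((T₁ + T₂) * (b * (c₁ * c₂) + a * (s₁ * s₂ * C) - C))

/-- The square of the distance of two lines in the notation of `normDot`. -/
noncomputable def normDist (a b t r s₁ c₁ T₁ s₂ c₂ T₂ C S : ℝ) : ℝ :=
  t⁻¹ * (normDet a b t r s₁ c₁ T₁ s₂ c₂ T₂ C S * normDet a b t r s₁ c₁ T₁ s₂ c₂ T₂ C S) *
    ((1 + t * (T₁ * T₁)) * (1 + t * (T₂ * T₂)) -
      normDot a b t r s₁ c₁ T₁ s₂ c₂ T₂ C S * normDot a b t r s₁ c₁ T₁ s₂ c₂ T₂ C S)⁻¹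

/-- The signs of `r`, of the sines of the latitudes and of `S` cancel in the normalized squared
distance. -/
theorem conjugateJets_normDist {ι : Type} [Fintype ι] [DecidableEq ι] {K : Type} [Field K]
    [Algebra K ℝ] {σ : K →+* K} {e : Equiv.Perm ι} {ε : ι → ℤˣ} {n : ℕ} (a b t : ℚ) {r : ℝ}
    (u η : ℤˣ) {s₁ c₁ T₁ s₂ c₂ T₂ C S s₁' c₁' T₁' s₂' c₂' T₂' C' S' : (ι → ℝ) → ℝ}
    (hr : ConjugateJets σ e ε n (fun _ => r) (fun _ => (u : ℤ) * r))
    (hs₁ : ConjugateJets σ e ε n s₁ (fun y => (η : ℤ) * s₁' y))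
    (hc₁ : ConjugateJets σ e ε n c₁ c₁') (hT₁ : ConjugateJets σ e ε n T₁ T₁')
    (hs₂ : ConjugateJets σ e ε n s₂ (fun y => (η : ℤ) * s₂' y))
    (hc₂ : ConjugateJets σ e ε n c₂ c₂') (hT₂ : ConjugateJets σ e ε n T₂ T₂')
    (hC : ConjugateJets σ e ε n C C')
    (hS : ConjugateJets σ e ε n S (fun y => ((u * η : ℤˣ) : ℤ) * S' y))
    (h0 : (1 + t * (T₁ 0 * T₁ 0)) * (1 + t * (T₂ 0 * T₂ 0)) -
      normDot a b t r (s₁ 0) (c₁ 0) (T₁ 0) (s₂ 0) (c₂ 0) (T₂ 0) (C 0) (S 0) *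
      normDot a b t r (s₁ 0) (c₁ 0) (T₁ 0) (s₂ 0) (c₂ 0) (T₂ 0) (C 0) (S 0) ≠ 0) :
    ConjugateJets σ e ε n
      (fun y => normDist a b t r (s₁ y) (c₁ y) (T₁ y) (s₂ y) (c₂ y) (T₂ y) (C y) (S y))
      (fun y => normDist a b t r (s₁' y) (c₁' y) (T₁' y) (s₂' y) (c₂' y) (T₂' y) (C' y) (S' y)) := by
  have hu := units_cast_mul_self u
  have hη := units_cast_mul_self η
  have rat (q : ℚ) := ConjugateJets.rat (σ := σ) (e := e) (ε := ε) q n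
  have hdot : ConjugateJets σ e ε n
      (fun y => normDot a b t r (s₁ y) (c₁ y) (T₁ y) (s₂ y) (c₂ y) (T₂ y) (C y) (S y))
      (fun y => normDot a b t r (s₁' y) (c₁' y) (T₁' y) (s₂' y) (c₂' y) (T₂' y) (C' y) (S' y)) := by
    refine (((((rat a).mul ((hs₁.mul hs₂).mul hC)).add ((rat b).mul (hc₁.mul hc₂))).add
      (hr.mul (((hT₁.mul hs₂).sub (hT₂.mul hs₁)).mul hS))).add
      ((rat t).mul ((hT₁.mul hT₂).mul hC))).congr (.of_forall fun y => rfl)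
      (.of_forall fun y => ?_)
    simp only [normDot, Units.val_mul, Int.cast_mul]
    linear_combination (a * (s₁' y * s₂' y * C' y) +
      r * ((T₁' y * s₂' y - T₂' y * s₁' y) * S' y)) * hη +
      r * ((T₁' y * s₂' y - T₂' y * s₁' y) * S' y) * ((η : ℤ) : ℝ) ^ 2 * hu
  have hdet : ConjugateJets σ e ε n
      (fun y => normDet a b t r (s₁ y) (c₁ y) (T₁ y) (s₂ y) (c₂ y) (T₂ y) (C y) (S y))
      (fun y => normDet a b t r (s₁' y) (c₁' y) (T₁' y) (s₂' y) (c₂' y) (T₂' y) (C' y) (S' y)) := by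
    refine ((hr.mul (((hs₁.sub hs₂).mul ((rat 1).sub ((rat t).mul (hT₁.mul hT₂)))).mul hS)).add
      ((rat t).mul ((hT₁.add hT₂).mul ((((rat b).mul (hc₁.mul hc₂)).add
      ((rat a).mul ((hs₁.mul hs₂).mul hC))).sub hC)))).congr
      (.of_forall fun y => by simp [normDet]) (.of_forall fun y => ?_)
    simp only [normDet, Units.val_mul, Int.cast_mul, Rat.cast_one]
    linear_combination (t * ((T₁' y + T₂' y) * (a * (s₁' y * s₂' y * C' y))) +
      r * ((s₁' y - s₂' y) * (1 - t * (T₁' y * T₂' y)) * S' y)) * hη +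
      r * ((s₁' y - s₂' y) * (1 - t * (T₁' y * T₂' y)) * S' y) * ((η : ℤ) : ℝ) ^ 2 * hu
  have hW := ((((rat 1).add ((rat t).mul (hT₁.mul hT₁))).mul
    ((rat 1).add ((rat t).mul (hT₂.mul hT₂)))).sub (hdot.mul hdot)).inv (by simpa using h0)
  refine (((rat t⁻¹).mul (hdet.mul hdet)).mul hW).congr (.of_forall fun y => ?_)
    (.of_forall fun y => ?_) <;> simp [normDist]

/-! ### Symmetries of the longitudes -/

/-- The value of `side` as an integer. -/
def sideZ : Label → ℤ
  | A | B | C => 1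
  | D | E | F => -1

/-- The cosine of `longitude J` is `lonCos J * √3 / 2`. -/
def lonCos : Label → ℤ
  | A | F => 1
  | B | E => -1
  | C | D => 0

/-- The sine of `longitude J` is `lonSin J / 2`. -/
def lonSin : Label → ℤ
  | A | B => 1
  | C => -2
  | D => 2
  | E | F => -1

/-- The cosine of `longitude L - longitude J`, multiplied by `4`. -/
def diffCos (J L : Label) : ℤ := 3 * (lonCos J * lonCos L) + lonSin J * lonSin L

/-- The sine of `longitude L - longitude J`, multiplied by `4 / √3`. -/
def diffSin (J L : Label) : ℤ := lonSin L * lonCos J - lonCos L * lonSin J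

theorem side_eq (J : Label) : side J = sideZ J := by cases J <;> simp [side, sideZ]

open Real in
theorem cos_longitude (J : Label) : cos (longitude J) = lonCos J * √3 / 2 := by
  cases J
  · simp [longitude, lonCos, cos_pi_div_six]
  · rw [longitude, show 5 * π / 6 = π - π / 6 by ring, cos_pi_sub, cos_pi_div_six]
    simp [lonCos, neg_div]
  · rw [longitude, show 3 * π / 2 = π / 2 + π by ring, cos_add_pi]
    simp [lonCos]
  · simp [longitude, lonCos]
  · rw [longitude, show 7 * π / 6 = π / 6 + π by ring, cos_add_pi, cos_pi_div_six]
    simp [lonCos, neg_div]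
  · rw [longitude, show 11 * π / 6 = 2 * π - π / 6 by ring, cos_two_pi_sub, cos_pi_div_six]
    simp [lonCos]

open Real in
theorem sin_longitude (J : Label) : sin (longitude J) = lonSin J / 2 := by
  cases J
  · simp [longitude, lonSin, sin_pi_div_six]
  · rw [longitude, show 5 * π / 6 = π - π / 6 by ring, sin_pi_sub, sin_pi_div_six]
    simp [lonSin]
  · rw [longitude, show 3 * π / 2 = π / 2 + π by ring, sin_add_pi]
    simp [lonSin]
  · simp [longitude, lonSin]
  · rw [longitude, show 7 * π / 6 = π / 6 + π by ring, sin_add_pi, sin_pi_div_six]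
    simp [lonSin, neg_div]
  · rw [longitude, show 11 * π / 6 = 2 * π - π / 6 by ring, sin_two_pi_sub, sin_pi_div_six]
    simp [lonSin, neg_div]

open Real in
theorem cos_longitude_sub (J L : Label) : cos (longitude L - longitude J) = diffCos J L / 4 := by
  have h3 : √3 * √3 = 3 := mul_self_sqrt (by norm_num)
  rw [cos_sub, cos_longitude, cos_longitude, sin_longitude, sin_longitude, diffCos]
  push_cast
  linear_combination (lonCos J * lonCos L / 4 : ℝ) * h3

open Real in
theorem sin_longitude_sub (J L : Label) :
    sin (longitude L - longitude J) = √3 * diffSin J L / 4 := by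
  rw [sin_sub, cos_longitude, cos_longitude, sin_longitude, sin_longitude, diffSin]
  push_cast
  ring

/-- The permutation `π` of the lines preserves (`η = 1`) or exchanges (`η = -1`) the hemispheres, and
it multiplies the differences of the longitudes by the sign `u * η`, modulo `2π`. The sign `u` tells
how the operator acts on the parameters `J_ϰ` and `J_δ` and on `𝔭_x`. -/
structure IsSymmetry (π : Equiv.Perm Label) (u η : ℤˣ) : Prop where
  sideZ : ∀ J, sideZ (π J) = η * sideZ J
  diffCos : ∀ J L, diffCos (π J) (π L) = diffCos J L
  diffSin : ∀ J L, diffSin (π J) (π L) = u * η * diffSin J L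

theorem isSymmetry_varpi : IsSymmetry varpi 1 1 :=
  ⟨fun J => by cases J <;> rfl, fun J L => by cases J <;> cases L <;> rfl,
    fun J L => by cases J <;> cases L <;> rfl⟩

theorem isSymmetry_varrho : IsSymmetry varrho 1 (-1) :=
  ⟨fun J => by cases J <;> rfl, fun J L => by cases J <;> cases L <;> rfl,
    fun J L => by cases J <;> cases L <;> rfl⟩

theorem isSymmetry_varsigma : IsSymmetry varsigma (-1) 1 :=
  ⟨fun J => by cases J <;> rfl, fun J L => by cases J <;> cases L <;> rfl,
    fun J L => by cases J <;> cases L <;> rfl⟩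

/-- The two kinds of pairs of lines: on the same side of the equator, with longitudes that differ by
`±2π/3`, or on different sides, with longitudes that differ by `±π/3` or `π`. -/
theorem label_pairs {J L : Label} (h : J ≠ L) :
    (sideZ J = sideZ L ∧ diffCos J L = -2) ∨
      (sideZ L = - sideZ J ∧ (diffSin J L ≠ 0 ∨ diffSin J L = 0 ∧ diffCos J L = -4)) := by
  revert h
  cases J <;> cases L <;> decide

theorem sideZ_mul_self (J : Label) : sideZ J * sideZ J = 1 := by cases J <;> rfl

/-! ### Differences of longitudes in the configuration -/

/-- The difference of the longitudes of the points of tangency of `J` and `L` in `C_{6,x}`. -/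
noncomputable def lonDiff (x : ℝ) (J L : Label) : ℝ :=
  longitude L - longitude J + (side L - side J) * baseAngle x kappa

section LonDiff

open Real

variable {x : ℝ}

/-- The factor `side L - side J` is `0`, `2` or `-2`, so that only the cosine and the sine of
`2 * ϰ(x)` occur. -/
theorem cos_sin_side_sub (h0 : 0 < x) (J L : Label) :
    cos ((side L - side J) * baseAngle x kappa) =
        1 - (1 - x * (3 + x) / (1 + x + 2 * x ^ 2)) * (sideZ L - sideZ J) ^ 2 / 4 ∧
      √3 * sin ((side L - side J) * baseAngle x kappa) =
        (sideZ L - sideZ J) / 2 * (3 * (x - 1) / (1 + x + 2 * x ^ 2)) * pX x := by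
  rw [← cos_two_kappa h0, mul_assoc, ← sqrt_three_mul_sin_two_kappa h0, side_eq, side_eq]
  have h (J : Label) : sideZ J = 1 ∨ sideZ J = -1 := by cases J <;> simp [sideZ]
  rcases h J with hJ | hJ <;> rcases h L with hL | hL <;> rw [hJ, hL]
  · simp
  · rw [show (((-1 : ℤ) : ℝ) - ((1 : ℤ) : ℝ)) * baseAngle x kappa = -(2 * baseAngle x kappa) by
      push_cast; ring, cos_neg, sin_neg]
    constructor <;> push_cast <;> ring
  · rw [show (((1 : ℤ) : ℝ) - ((-1 : ℤ) : ℝ)) * baseAngle x kappa = 2 * baseAngle x kappa by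
      push_cast; ring]
    constructor <;> push_cast <;> ring
  · simp

theorem cos_lonDiff (h0 : 0 < x) (J L : Label) : cos (lonDiff x J L) =
    diffCos J L / 4 * (1 - (1 - x * (3 + x) / (1 + x + 2 * x ^ 2)) *
      (sideZ L - sideZ J) ^ 2 / 4) -
    diffSin J L / 4 * ((sideZ L - sideZ J) / 2 * (3 * (x - 1) / (1 + x + 2 * x ^ 2))) * pX x := by
  obtain ⟨h₁, h₂⟩ := cos_sin_side_sub h0 J L
  rw [lonDiff, cos_add, cos_longitude_sub, sin_longitude_sub, h₁]
  linear_combination -(diffSin J L / 4 : ℝ) * h₂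

theorem sin_lonDiff (h0 : 0 < x) (J L : Label) : (√3)⁻¹ * sin (lonDiff x J L) =
    diffSin J L / 4 * (1 - (1 - x * (3 + x) / (1 + x + 2 * x ^ 2)) *
      (sideZ L - sideZ J) ^ 2 / 4) +
    diffCos J L / 12 * ((sideZ L - sideZ J) / 2 * (3 * (x - 1) / (1 + x + 2 * x ^ 2))) * pX x := by
  obtain ⟨h₁, h₂⟩ := cos_sin_side_sub h0 J L
  have h3 : √3 * √3 = 3 := mul_self_sqrt (by norm_num)
  have h3'' : (√3)⁻¹ = √3 / 3 := inv_eq_of_mul_eq_one_left (by linear_combination h3 / 3)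
  rw [lonDiff, sin_add, cos_longitude_sub, sin_longitude_sub, h₁, h3'']
  linear_combination (diffCos J L / 12 : ℝ) * h₂ + (diffSin J L / 12 * (1 - (1 - x * (3 + x) /
    (1 + x + 2 * x ^ 2)) * (sideZ L - sideZ J) ^ 2 / 4)) * h3

/-! ### No two lines of the configuration are parallel -/

/-- Two lines on the same side of the equator are not parallel. -/
theorem normDot_ne_of_same {a t r s C S : ℝ} (ha0 : 0 < a) (ha1 : a < 1) (ht : 0 < t)
    (hs : s * s = 1) (hC : C = -1 / 2) :
    (1 + t) * (1 + t) - normDot a (1 - a) t r s 1 1 s 1 1 C S *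
      normDot a (1 - a) t r s 1 1 s 1 1 C S ≠ 0 := by
  have hU : normDot a (1 - a) t r s 1 1 s 1 1 C S = 1 - a - (a + t) / 2 := by
    rw [normDot, hs, hC]; ring
  rw [hU]
  nlinarith [mul_pos (show 0 < t + a + (a + t) / 2 by positivity)
    (show 0 < 2 + t / 2 - 3 * a / 2 by linarith)]

/-- Two lines on different sides of the equator can only be parallel for one value of the cosine of
the difference of their longitudes: the equality case of the Cauchy-Schwarz inequality. -/
theorem eq_of_normDot_eq {a t r s C S : ℝ} (ha0 : 0 < a) (ha1 : a < 1) (ht : 0 < t)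
    (hs : s * s = 1) (hr : r ^ 2 = 3 * (t * a)) (hCS : C ^ 2 + 3 * S ^ 2 = 1)
    (h : (1 + t) * (1 + t) - normDot a (1 - a) t r s 1 1 (-s) 1 1 C S *
      normDot a (1 - a) t r s 1 1 (-s) 1 1 C S = 0) : C * (t + a) = t - a := by
  set V := (t - a) * C - 2 * (r * s) * S with hV
  have hU : normDot a (1 - a) t r s 1 1 (-s) 1 1 C S = V + (1 - a) := by
    rw [normDot, hV]; linear_combination (-(a * C)) * hs
  have hlag : 3 * (t + a) ^ 2 - 3 * V ^ 2 = (3 * (t - a) * S + 2 * (r * s) * C) ^ 2 := by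
    rw [hV]
    linear_combination (-3 * (t + a) ^ 2) * hCS - 4 * (C ^ 2 + 3 * S ^ 2) * r ^ 2 * hs -
      4 * (C ^ 2 + 3 * S ^ 2) * hr
  rw [hU] at h
  have hfac : (t + a - V) * (2 + t - a + V) = 0 := by linear_combination h
  rcases mul_eq_zero.1 hfac with h1 | h1
  · have hV1 : V = t + a := by linarith
    rw [hV1] at hlag
    have h2 : 3 * (t - a) * S + 2 * (r * s) * C = 0 := by
      rw [← sq_eq_zero_iff, ← hlag]; ring
    have h3 : (t + a) * (C * (t + a)) = (t + a) * (t - a) := by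
      rw [hV1] at hV
      linear_combination (-(t - a)) * hV + (2 * (r * s) / 3) * h2 - 4 / 3 * C * hr -
        4 / 3 * C * r ^ 2 * hs
    exact mul_left_cancel₀ (by positivity) h3
  · have hV1 : V = -(2 + t - a) := by linarith
    have h4 : 0 ≤ 3 * (t + a) ^ 2 - 3 * V ^ 2 := hlag ▸ sq_nonneg _
    rw [hV1] at h4
    nlinarith

end LonDiff

/-- No two lines of `C_{6,x}` are parallel. For most pairs on different sides of the equator, the
cosine of the difference of longitudes is irrational, while parallel lines require a rational one. -/
theorem normDot_ne {x : ℚ} (h0 : 0 < x) (h1 : x < 1) (hp : Irrational (pX x)) {J L : Label}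
    (h : J ≠ L) {a t r : ℝ} (ha : a = 4 * ((1 - x) * x * (1 + x)) / (1 + 7 * x + 4 * x ^ 2))
    (ha1 : a < 1) (ht : t = (1 - x) * (1 + 3 * x) / (x * (1 + 7 * x + 4 * x ^ 2)))
    (hr : r ^ 2 = 3 * (t * a)) :
    (1 + t) * (1 + t) - normDot a (1 - a) t r (side J) 1 1 (side L) 1 1
        (Real.cos (lonDiff x J L)) ((√3)⁻¹ * Real.sin (lonDiff x J L)) *
      normDot a (1 - a) t r (side J) 1 1 (side L) 1 1
        (Real.cos (lonDiff x J L)) ((√3)⁻¹ * Real.sin (lonDiff x J L)) ≠ 0 := by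
  have hx0 : (0 : ℝ) < x := by exact_mod_cast h0
  have hx1 : (0 : ℝ) < 1 - x := by
    have : (x : ℝ) < 1 := by exact_mod_cast h1
    linarith
  have ha0 : 0 < a := by rw [ha]; positivity
  have ht0 : 0 < t := by rw [ht]; positivity
  have hss : side J * side J = 1 := by rw [side_eq]; exact_mod_cast sideZ_mul_self J
  rcases label_pairs h with ⟨hside, hcos⟩ | ⟨hside, hcase⟩
  · rw [side_eq L, ← hside, ← side_eq J]
    refine normDot_ne_of_same ha0 ha1 ht0 hss ?_
    rw [cos_lonDiff hx0, hside, hcos]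
    push_cast; ring
  · rw [side_eq L, hside, Int.cast_neg, ← side_eq J]
    intro hpar
    have hCS : Real.cos (lonDiff x J L) ^ 2 + 3 * ((√3)⁻¹ * Real.sin (lonDiff x J L)) ^ 2 = 1 := by
      rw [mul_pow, inv_pow, Real.sq_sqrt (by norm_num)]
      linear_combination Real.cos_sq_add_sin_sq (lonDiff x J L)
    have hC := eq_of_normDot_eq ha0 ha1 ht0 hss hr hCS hpar
    have hC' : Real.cos (lonDiff x J L) = (1 + 3 * x - 4 * x ^ 2 - 4 * x ^ 3) /
        ((1 + 2 * x) * (1 + x + 2 * x ^ 2)) := by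
      rw [ha, ht] at hC
      rw [eq_div_iff (by positivity)]
      field_simp at hC
      linear_combination hC
    rw [cos_lonDiff hx0, hside] at hC'
    rcases hcase with hne | ⟨hs0, hc4⟩
    · have hJ : (sideZ J : ℝ) ≠ 0 := by
        intro h; rw [side_eq, h] at hss; norm_num at hss
      have hne' : (diffSin J L : ℚ) / 4 * ((-sideZ J - sideZ J) / 2 *
          (3 * (x - 1) / (1 + x + 2 * x ^ 2))) ≠ 0 := by
        have hJq : (sideZ J : ℚ) ≠ 0 := by exact_mod_cast hJ
        have h2 : (-sideZ J - sideZ J : ℚ) ≠ 0 := by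
          intro h; apply hJq; linarith
        have h3 : (diffSin J L : ℚ) ≠ 0 := by exact_mod_cast hne
        have h4 : x - 1 ≠ 0 := by linarith
        have h5 : (1 + x + 2 * x ^ 2) ≠ 0 := by positivity
        positivity
      refine (hp.ratCast_mul hne').ne_rat ((diffCos J L : ℚ) / 4 *
        (1 - (1 - x * (3 + x) / (1 + x + 2 * x ^ 2)) * (-sideZ J - sideZ J) ^ 2 / 4) -
        (1 + 3 * x - 4 * x ^ 2 - 4 * x ^ 3) / ((1 + 2 * x) * (1 + x + 2 * x ^ 2))) ?_
      push_cast at hC' ⊢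
      linear_combination -hC'
    · have hZ : (sideZ J : ℝ) * sideZ J = 1 := by rw [← side_eq]; exact hss
      rw [hs0, hc4, Int.cast_neg] at hC'
      have hC2 : -(x * (3 + x) / (1 + x + 2 * x ^ 2) : ℝ) = (1 + 3 * x - 4 * x ^ 2 - 4 * x ^ 3) /
        ((1 + 2 * x) * (1 + x + 2 * x ^ 2)) := by
        rw [← hC']; push_cast
        linear_combination (-(1 - x * (3 + x) / (1 + x + 2 * x ^ 2)) : ℝ) * hZ
      field_simp at hC2
      nlinarith [mul_pos hx0 hx0, mul_pos (mul_pos hx0 hx0) hx1]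

/-! ### Jets of the squared distances -/

/-- The normalization constants: with them, the functions `sin / sin φ(x)`, `cos / cos φ(x)` of the
latitudes, `tan / tan δ(x)` of the inclinations, and `cos`, `sin / √3` of the differences of
longitudes solve differential equations over `ℚ[𝔭_x]`. -/
noncomputable def normConst (x : ℝ) : Coord → ℝ
  | kappa => √3
  | phi => Real.sin (baseAngle x phi) * Real.cos (baseAngle x phi)
  | delta => Real.tan (baseAngle x delta) * pX x

/-- The sine of the latitude of the point of tangency of `J`, up to the sign `side J`, divided by its
value in the configuration. -/
noncomputable def latSin (x : ℝ) (J : Label) (y : Label × Coord → ℝ) : ℝ :=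
  (Real.sin (baseAngle x phi))⁻¹ * Real.sin (baseAngle x phi + normConst x phi * y (J, phi))

/-- The cosine of the latitude of `J`, divided by its value in the configuration. -/
noncomputable def latCos (x : ℝ) (J : Label) (y : Label × Coord → ℝ) : ℝ :=
  (Real.cos (baseAngle x phi))⁻¹ * Real.cos (baseAngle x phi + normConst x phi * y (J, phi))

/-- The tangent of the inclination of `J`, divided by its value in the configuration. -/
noncomputable def incTan (x : ℝ) (J : Label) (y : Label × Coord → ℝ) : ℝ :=
  (Real.tan (baseAngle x delta))⁻¹ *
    Real.tan (baseAngle x delta + Real.tan (baseAngle x delta) * pX x * y (J, delta))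

/-- The derivative of the difference of the longitudes of `J` and `L` along the parameter `i`. -/
noncomputable def lonSlope (J L : Label) (i : Label × Coord) : ℝ :=
  √3 * (((if i = (L, kappa) then sideZ L else 0) - (if i = (J, kappa) then sideZ J else 0) : ℤ) : ℝ)

/-- The difference of the longitudes of the perturbed lines `J` and `L`. -/
noncomputable def lonAngle (x : ℝ) (J L : Label) (y : Label × Coord → ℝ) : ℝ :=
  lonDiff x J L + ∑ i, lonSlope J L i * y i

theorem lonAngle_eq (x : ℝ) (J L : Label) (y : Label × Coord → ℝ) : lonAngle x J L y =
    longitude L + side L * (baseAngle x kappa + normConst x kappa * y (L, kappa)) -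
      (longitude J + side J * (baseAngle x kappa + normConst x kappa * y (J, kappa))) := by
  have : ∑ i, lonSlope J L i * y i =
      √3 * (side L * y (L, kappa)) - √3 * (side J * y (J, kappa)) := by
    simp [lonSlope, side_eq, mul_sub, sub_mul, Finset.sum_sub_distrib, mul_assoc]
  rw [lonAngle, this, lonDiff, normConst]
  ring

/-- The squared distance of the perturbed lines `J` and `L` in terms of the normalized functions. -/
noncomputable def distExpr (x : ℝ) (J L : Label) (y : Label × Coord → ℝ) : ℝ :=
  normDist (Real.sin (baseAngle x phi) ^ 2) (1 - Real.sin (baseAngle x phi) ^ 2)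
    (Real.tan (baseAngle x delta) ^ 2)
    (√3 * (Real.tan (baseAngle x delta) * Real.sin (baseAngle x phi)))
    (side J * latSin x J y) (latCos x J y) (incTan x J y)
    (side L * latSin x L y) (latCos x L y) (incTan x L y)
    (Real.cos (lonAngle x J L y)) ((√3)⁻¹ * Real.sin (lonAngle x J L y))

/-- The expression `dotNum` of the perturbed lines `J` and `L` in terms of the normalized functions. -/
noncomputable def dotExpr (x : ℝ) (J L : Label) (y : Label × Coord → ℝ) : ℝ :=
  normDot (Real.sin (baseAngle x phi) ^ 2) (1 - Real.sin (baseAngle x phi) ^ 2)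
    (Real.tan (baseAngle x delta) ^ 2)
    (√3 * (Real.tan (baseAngle x delta) * Real.sin (baseAngle x phi)))
    (side J * latSin x J y) (latCos x J y) (incTan x J y)
    (side L * latSin x L y) (latCos x L y) (incTan x L y)
    (Real.cos (lonAngle x J L y)) ((√3)⁻¹ * Real.sin (lonAngle x J L y))

/-- The denominator of the squared distance; it vanishes when the lines are parallel. -/
noncomputable def denExpr (x : ℝ) (J L : Label) (y : Label × Coord → ℝ) : ℝ :=
  (1 + Real.tan (baseAngle x delta) ^ 2 * (incTan x J y * incTan x J y)) *
    (1 + Real.tan (baseAngle x delta) ^ 2 * (incTan x L y * incTan x L y)) -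
      dotExpr x J L y * dotExpr x J L y

section Config

variable {x : ℚ}

theorem denExpr_zero_ne (h0 : 0 < x) (h1 : x < 1) (hp : Irrational (pX x)) {J L : Label}
    (h : J ≠ L) : denExpr x J L 0 ≠ 0 := by
  set a := Real.sin (baseAngle x phi) ^ 2 with ha
  set t := Real.tan (baseAngle x delta) ^ 2 with ht
  set r := √3 * (Real.tan (baseAngle x delta) * Real.sin (baseAngle x phi)) with hr
  have h0' : (0 : ℝ) < x := by exact_mod_cast h0
  have h1' : (x : ℝ) < 1 := by exact_mod_cast h1
  have hs := (sin_phi_pos h0' h1').ne'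
  have hc := (cos_phi_pos h0' h1').ne'
  have hT := (tan_delta_pos h0' h1').ne'
  have e₁ (J : Label) : latSin x J 0 = 1 := by simp [latSin, hs]
  have e₂ (J : Label) : latCos x J 0 = 1 := by simp [latCos, hc]
  have e₃ (J : Label) : incTan x J 0 = 1 := by
    rw [incTan, Pi.zero_apply, mul_zero, add_zero, inv_mul_cancel₀ hT]
  have e₄ : lonAngle x J L 0 = lonDiff x J L := by simp [lonAngle]
  have ha1 : a < 1 := by
    have := Real.sin_sq_add_cos_sq (baseAngle x phi)
    have := pow_pos (cos_phi_pos h0' h1') 2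
    rw [ha]; linarith
  have hr2 : r ^ 2 = 3 * (t * a) := by
    rw [hr, ht, ha, mul_pow, mul_pow, Real.sq_sqrt (by norm_num)]
  have := normDot_ne h0 h1 hp h (sin_phi_sq h0' h1') ha1 (tan_delta_sq h0' h1') hr2
  simpa only [denExpr, dotExpr, e₁, e₂, e₃, e₄, mul_one] using this

/-- Near the origin, `J` and `L` are not parallel and their inclinations have a nonzero cosine, so that
the squared distance is given by the rational expression. -/
theorem sqDist_eventuallyEq (h0 : 0 < x) (h1 : x < 1) (hp : Irrational (pX x)) {J L : Label}
    (h : J ≠ L) : sqDist x (normConst x) J L =ᶠ[𝓝 0] distExpr x J L := by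
  have h0' : (0 : ℝ) < x := by exact_mod_cast h0
  have h1' : (x : ℝ) < 1 := by exact_mod_cast h1
  have hs := (sin_phi_pos h0' h1').ne'
  have hc := (cos_phi_pos h0' h1').ne'
  have hT := (tan_delta_pos h0' h1').ne'
  have hd := (cos_delta_pos x).ne'
  have hcont (J : Label) (υ : Coord) (b c : ℝ) :
      Continuous fun y : Label × Coord → ℝ => b + c * y (J, υ) := by fun_prop
  have hcosc (J : Label) (υ : Coord) (b c : ℝ) := Real.continuous_cos.comp (hcont J υ b c)
  have hsinc (J : Label) (υ : Coord) (b c : ℝ) := Real.continuous_sin.comp (hcont J υ b c)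
  have hcos (J : Label) : ∀ᶠ y in 𝓝 (0 : Label × Coord → ℝ), Real.cos (baseAngle x delta +
      Real.tan (baseAngle x delta) * pX x * y (J, delta)) ≠ 0 := by
    refine (hcosc J delta _ _).continuousAt.eventually_ne ?_
    simpa using hd
  have hTc (J : Label) : ContinuousAt (incTan x J) 0 := by
    unfold incTan
    simp only [Real.tan_eq_sin_div_cos (_ + _)]
    refine continuousAt_const.mul ((hsinc J delta _ _).continuousAt.div
      (hcosc J delta _ _).continuousAt ?_)
    simpa using hd
  have hSc (J : Label) : ContinuousAt (latSin x J) 0 :=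
    continuousAt_const.mul (hsinc J phi _ _).continuousAt
  have hCc (J : Label) : ContinuousAt (latCos x J) 0 :=
    continuousAt_const.mul (hcosc J phi _ _).continuousAt
  have hLc : Continuous (lonAngle x J L) := by
    have : lonAngle x J L = fun y => _ := funext (lonAngle_eq x J L)
    rw [this]; fun_prop
  have hC : ContinuousAt (fun y => Real.cos (lonAngle x J L y)) 0 :=
    (Real.continuous_cos.comp hLc).continuousAt
  have hS : ContinuousAt (fun y => Real.sin (lonAngle x J L y)) 0 :=
    (Real.continuous_sin.comp hLc).continuousAt
  have hWc : ContinuousAt (denExpr x J L) 0 := by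
    have := hTc J
    have := hTc L
    have := hSc J
    have := hSc L
    have := hCc J
    have := hCc L
    unfold denExpr dotExpr normDot
    fun_prop
  filter_upwards [hcos J, hcos L, hWc.eventually_ne (denExpr_zero_ne h0 h1 hp h)] with y hJ hL hW
  have es (J : Label) (φ : ℝ) : Real.sin (side J * φ) = side J * Real.sin φ := by
    cases J <;> simp [side]
  have ec (J : Label) (φ : ℝ) : Real.cos (side J * φ) = Real.cos φ := by
    cases J <;> simp [side]
  have fs (J : Label) : Real.sin (baseAngle x phi + normConst x phi * y (J, phi)) =
      Real.sin (baseAngle x phi) * latSin x J y := by rw [latSin]; field_simp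
  have fc (J : Label) : Real.cos (baseAngle x phi + normConst x phi * y (J, phi)) =
      Real.cos (baseAngle x phi) * latCos x J y := by rw [latCos]; field_simp
  have ft (J : Label) : Real.tan (baseAngle x delta + normConst x delta * y (J, delta)) =
      Real.tan (baseAngle x delta) * incTan x J y := by
    rw [incTan, normConst, mul_inv_cancel_left₀ hT]
  have fS : Real.sin (lonAngle x J L y) = √3 * ((√3)⁻¹ * Real.sin (lonAngle x J L y)) := by
    rw [mul_inv_cancel_left₀ (by positivity)]
  have hcs := Real.sin_sq_add_cos_sq (baseAngle x phi)
  have hdot : dotNum (side J * (Real.sin (baseAngle x phi) * latSin x J y))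
      (Real.cos (baseAngle x phi) * latCos x J y) (Real.tan (baseAngle x delta) * incTan x J y)
      (side L * (Real.sin (baseAngle x phi) * latSin x L y))
      (Real.cos (baseAngle x phi) * latCos x L y) (Real.tan (baseAngle x delta) * incTan x L y)
      (Real.cos (lonAngle x J L y)) (√3 * ((√3)⁻¹ * Real.sin (lonAngle x J L y))) =
      dotExpr x J L y := by
    rw [dotExpr, dotNum, normDot]
    linear_combination (latCos x J y * latCos x L y) * hcs
  have hdet : Real.tan (baseAngle x delta) *
      detNum (side J * (Real.sin (baseAngle x phi) * latSin x J y))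
      (Real.cos (baseAngle x phi) * latCos x J y) (Real.tan (baseAngle x delta) * incTan x J y)
      (side L * (Real.sin (baseAngle x phi) * latSin x L y))
      (Real.cos (baseAngle x phi) * latCos x L y) (Real.tan (baseAngle x delta) * incTan x L y)
      (Real.cos (lonAngle x J L y)) (√3 * ((√3)⁻¹ * Real.sin (lonAngle x J L y))) =
      normDet (Real.sin (baseAngle x phi) ^ 2) (1 - Real.sin (baseAngle x phi) ^ 2)
        (Real.tan (baseAngle x delta) ^ 2)
        (√3 * (Real.tan (baseAngle x delta) * Real.sin (baseAngle x phi)))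
        (side J * latSin x J y) (latCos x J y) (incTan x J y)
        (side L * latSin x L y) (latCos x L y) (incTan x L y)
        (Real.cos (lonAngle x J L y)) ((√3)⁻¹ * Real.sin (lonAngle x J L y)) := by
    rw [detNum, normDet]
    linear_combination (Real.tan (baseAngle x delta) ^ 2 * (incTan x J y + incTan x L y) *
      (latCos x J y * latCos x L y)) * hcs
  have hden : (1 + (Real.tan (baseAngle x delta) * incTan x J y) ^ 2) *
      (1 + (Real.tan (baseAngle x delta) * incTan x L y) ^ 2) - dotExpr x J L y ^ 2 =
      denExpr x J L y := by
    rw [denExpr]; ring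
  have hform := lineDist_tangentLine_sq
    (φ₁ := side J * (baseAngle x phi + normConst x phi * y (J, phi)))
    (l₁ := longitude J + side J * (baseAngle x kappa + normConst x kappa * y (J, kappa)))
    (δ₁ := baseAngle x delta + normConst x delta * y (J, delta))
    (φ₂ := side L * (baseAngle x phi + normConst x phi * y (L, phi)))
    (l₂ := longitude L + side L * (baseAngle x kappa + normConst x kappa * y (L, kappa)))
    (δ₂ := baseAngle x delta + normConst x delta * y (L, delta)) hJ hL
  rw [← lonAngle_eq, es, es, ec, ec, fs, fs, fc, fc, ft, ft, fS, hdot, hden] at hform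
  change lineDist (tangentLine _ _ _) (tangentLine _ _ _) ^ 2 = _
  rw [hform hW, distExpr, normDist, ← hdet]
  change _ = _ * (denExpr x J L y)⁻¹
  field_simp

end Config

section Jets

variable {x : ℚ} {K : Type} [Field K] [Algebra K ℝ] {σ : K →+* K} {γ : K} {τ : Equiv.Perm Label}
  {u η : ℤˣ} {ε : Coord → ℤˣ}

open Real in
theorem conjugateJets_lat (h0 : 0 < x) (h1 : x < 1) (hε : ε phi = 1) (J : Label) (n : ℕ) :
    ConjugateJets σ (τ.prodCongr (Equiv.refl Coord)) (fun i => ε i.2) n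
        (latCos x J) (latCos x (τ J)) ∧
      ConjugateJets σ (τ.prodCongr (Equiv.refl Coord)) (fun i => ε i.2) n
        (latSin x J) (latSin x (τ J)) := by
  have h0' : (0 : ℝ) < x := by exact_mod_cast h0
  have h1' : (x : ℝ) < 1 := by exact_mod_cast h1
  have hs := (sin_phi_pos h0' h1').ne'
  have hc := (cos_phi_pos h0' h1').ne'
  obtain ⟨q, hq⟩ : ∃ q : ℚ, sin (baseAngle x phi) ^ 2 = q :=
    ⟨4 * ((1 - x) * x * (1 + x)) / (1 + 7 * x + 4 * x ^ 2), by
      rw [sin_phi_sq h0' h1']; push_cast; ring⟩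
  have hq' : cos (baseAngle x phi) ^ 2 = ((1 - q : ℚ) : ℝ) := by
    rw [cos_sq', hq]; push_cast; ring
  have h := conjugateJets_cos_sin (σ := σ) (e := τ.prodCongr (Equiv.refl Coord))
    (ε := fun i => ε i.2) (α := (cos (baseAngle x phi))⁻¹) (β := (sin (baseAngle x phi))⁻¹)
    (c := baseAngle x phi) (c' := baseAngle x phi)
    (m := fun i => if i = (J, phi) then normConst x phi else 0)
    (m' := fun i => if i = (τ J, phi) then normConst x phi else 0) 1 ?_ ?_ ?_
    ⟨1, by simp [hc], by simp [hc]⟩ ⟨1, by simp [hs], by simp [hs]⟩ n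
  · simp only [ite_mul, zero_mul, Finset.sum_ite_eq', Finset.mem_univ, if_true, Units.val_one,
      Int.cast_one, one_mul] at h
    exact h
  · rintro ⟨M, υ⟩
    by_cases hM : M = J ∧ υ = phi
    · obtain ⟨rfl, rfl⟩ := hM
      simp [hε]
    · simp [hM]
  · intro i
    by_cases hi : i = (J, phi)
    · refine ⟨q, ?_⟩
      simp only [hi, if_true, normConst, ← hq]
      field_simp
    · exact ⟨0, by simp [hi]⟩
  · intro i
    by_cases hi : i = (J, phi)
    · refine ⟨1 - q, ?_⟩
      simp only [hi, if_true, normConst, ← hq']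
      field_simp
    · exact ⟨0, by simp [hi]⟩

open Real in
theorem conjugateJets_inc (h0 : 0 < x) (h1 : x < 1) (hγ : algebraMap K ℝ γ = pX x)
    (hσ : σ γ = ((u : ℤ) : K) * γ) (hε : ε delta = u) (J : Label) (n : ℕ) :
    ConjugateJets σ (τ.prodCongr (Equiv.refl Coord)) (fun i => ε i.2) n
        (incTan x J) (incTan x (τ J)) := by
  have h0' : (0 : ℝ) < x := by exact_mod_cast h0
  have h1' : (x : ℝ) < 1 := by exact_mod_cast h1
  refine conjugateJets_tan (e := τ.prodCongr (Equiv.refl Coord)) (ε := fun i => ε i.2)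
    (q := (1 - x) * (1 + 3 * x) / (x * (1 + 7 * x + 4 * x ^ 2)))
    (tan_delta_pos h0' h1').ne' rfl (cos_delta_pos x).ne' ?_ (j := (J, delta)) (fun n => ?_) n
  · rw [tan_delta_sq h0' h1']; push_cast; ring
  · have := ConjugateJets.const (σ := σ) (e := τ.prodCongr (Equiv.refl Coord))
      (ε := fun i => ε i.2) γ n
    simpa [hγ, hσ, hε] using this

open Real in
theorem conjugateJets_lon (h0 : 0 < x) (hγ : algebraMap K ℝ γ = pX x)
    (hσ : σ γ = ((u : ℤ) : K) * γ) (hε : ε kappa = u) (hτ : IsSymmetry τ u η) (J L : Label)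
    (n : ℕ) :
    ConjugateJets σ (τ.prodCongr (Equiv.refl Coord)) (fun i => ε i.2) n
        (fun y => cos (lonAngle x J L y)) (fun y => cos (lonAngle x (τ J) (τ L) y)) ∧
      ConjugateJets σ (τ.prodCongr (Equiv.refl Coord)) (fun i => ε i.2) n
        (fun y => (√3)⁻¹ * sin (lonAngle x J L y))
        (fun y => ((u * η : ℤˣ) : ℤ) * ((√3)⁻¹ * sin (lonAngle x (τ J) (τ L) y))) := by
  have h0' : (0 : ℝ) < x := by exact_mod_cast h0
  have h3 : √3 * √3 = 3 := mul_self_sqrt (by norm_num)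
  have h3' : √3 ≠ 0 := by positivity
  -- the coefficients of `1` and of `pX x` in the cosine and the sine of the difference
  set a : ℚ := 1 - (1 - x * (3 + x) / (1 + x + 2 * x ^ 2)) * (sideZ L - sideZ J) ^ 2 / 4 with ha
  set b : ℚ := (sideZ L - sideZ J) / 2 * (3 * (x - 1) / (1 + x + 2 * x ^ 2)) with hb
  have h := conjugateJets_cos_sin (σ := σ) (e := τ.prodCongr (Equiv.refl Coord))
    (ε := fun i => ε i.2) (α := 1) (β := (√3)⁻¹) (c := lonDiff x J L)
    (c' := lonDiff x (τ J) (τ L)) (m := lonSlope J L) (m' := lonSlope (τ J) (τ L)) (u * η)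
    ?_ ?_ ?_ ?_ ?_ n
  · simpa only [one_mul, lonAngle] using h
  · rintro ⟨M, υ⟩
    by_cases hυ : υ = kappa
    · subst hυ
      simp only [lonSlope, Equiv.prodCongr_apply, Prod.map, Equiv.refl_apply, Prod.mk.injEq,
        EmbeddingLike.apply_eq_iff_eq, and_true, hτ.sideZ, hε, Units.val_mul]
      push_cast
      rcases Int.units_eq_one_or u with rfl | rfl <;> split_ifs <;> push_cast <;> ring
    · simp [lonSlope, hυ]
  · intro i
    obtain ⟨k, hk⟩ : ∃ k : ℤ, lonSlope J L i = √3 * k := ⟨_, rfl⟩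
    refine ⟨3 * k, ?_⟩
    rw [hk, one_mul, eq_mul_inv_iff_mul_eq₀ h3']
    push_cast
    linear_combination (k : ℝ) * h3
  · intro i
    obtain ⟨k, hk⟩ : ∃ k : ℤ, lonSlope J L i = √3 * k := ⟨_, rfl⟩
    refine ⟨k, ?_⟩
    rw [hk, inv_mul_cancel_left₀ h3', mul_one, Rat.cast_intCast]
  · refine ⟨((diffCos J L / 4 * a : ℚ) : K) - ((diffSin J L / 4 * b : ℚ) : K) * γ, ?_, ?_⟩
    · rw [one_mul, cos_lonDiff h0', map_sub, map_mul, map_ratCast, map_ratCast, hγ, ha, hb]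
      push_cast; ring
    · rw [one_mul, cos_lonDiff h0', map_sub, map_mul, map_ratCast, map_ratCast, hσ, map_sub,
        map_mul, map_mul, map_ratCast, map_ratCast, hγ, map_intCast, ha, hb, hτ.diffCos, hτ.diffSin,
        hτ.sideZ, hτ.sideZ]
      push_cast
      rcases Int.units_eq_one_or η with rfl | rfl <;> push_cast <;> ring
  · refine ⟨((diffSin J L / 4 * a : ℚ) : K) + ((diffCos J L / 12 * b : ℚ) : K) * γ, ?_, ?_⟩
    · rw [sin_lonDiff h0', map_add, map_mul, map_ratCast, map_ratCast, hγ, ha, hb]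
      push_cast; ring
    · rw [sin_lonDiff h0', map_add, map_mul, map_ratCast, map_ratCast, hσ, map_add,
        map_mul, map_mul, map_ratCast, map_ratCast, hγ, map_intCast, ha, hb, hτ.diffCos, hτ.diffSin,
        hτ.sideZ, hτ.sideZ]
      push_cast
      rcases Int.units_eq_one_or η with rfl | rfl <;>
        rcases Int.units_eq_one_or u with rfl | rfl <;> push_cast <;> ring

/-- A symmetry of the longitudes, combined with the conjugation of the coefficients when it changes
their orientation, maps the jets of the squared distances to each other. -/
theorem conjugateJets_sqDist (h0 : 0 < x) (h1 : x < 1) (hp : Irrational (pX x))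
    (hγ : algebraMap K ℝ γ = pX x) (hσ : σ γ = ((u : ℤ) : K) * γ) (hκ : ε kappa = u)
    (hφ : ε phi = 1) (hδ : ε delta = u) (hτ : IsSymmetry τ u η) {J L : Label} (h : J ≠ L) (n : ℕ) :
    ConjugateJets σ (τ.prodCongr (Equiv.refl Coord)) (fun i => ε i.2) n
      (sqDist x (normConst x) J L) (sqDist x (normConst x) (τ J) (τ L)) := by
  have h0' : (0 : ℝ) < x := by exact_mod_cast h0
  have h1' : (x : ℝ) < 1 := by exact_mod_cast h1
  refine ConjugateJets.congr ?_ (sqDist_eventuallyEq h0 h1 hp h).symm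
    (sqDist_eventuallyEq h0 h1 hp (τ.injective.ne h)).symm
  obtain ⟨a, ha⟩ : ∃ q : ℚ, Real.sin (baseAngle x phi) ^ 2 = q :=
    ⟨4 * ((1 - x) * x * (1 + x)) / (1 + 7 * x + 4 * x ^ 2), by
      rw [sin_phi_sq h0' h1']; push_cast; ring⟩
  obtain ⟨t, ht⟩ : ∃ q : ℚ, Real.tan (baseAngle x delta) ^ 2 = q :=
    ⟨(1 - x) * (1 + 3 * x) / (x * (1 + 7 * x + 4 * x ^ 2)), by
      rw [tan_delta_sq h0' h1']; push_cast; ring⟩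
  have hs (J : Label) : ConjugateJets σ (τ.prodCongr (Equiv.refl Coord)) (fun i => ε i.2) n
      (fun y => side J * latSin x J y)
      (fun y => (η : ℤ) * (side (τ J) * latSin x (τ J) y)) := by
    refine ((conjugateJets_lat h0 h1 hφ J n).2.int_mul (sideZ J)).congr
      (.of_forall fun y => by simp only [side_eq]) (.of_forall fun y => ?_)
    simp only [side_eq, hτ.sideZ]
    push_cast
    linear_combination -(sideZ J * latSin x (τ J) y) * units_cast_mul_self η
  have hr : ConjugateJets σ (τ.prodCongr (Equiv.refl Coord)) (fun i => ε i.2) n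
      (fun _ => √3 * (Real.tan (baseAngle x delta) * Real.sin (baseAngle x phi)))
      (fun _ => (u : ℤ) * (√3 * (Real.tan (baseAngle x delta) * Real.sin (baseAngle x phi)))) := by
    refine (ConjugateJets.const (((6 * (1 - x) / (1 + 7 * x + 4 * x ^ 2) : ℚ) : K) * γ) n).congr
      (.of_forall fun y => ?_) (.of_forall fun y => ?_)
    · simp only [sqrt_three_mul_tan_mul_sin h0' h1', map_mul, map_ratCast, hγ]
      push_cast; ring
    · simp only [sqrt_three_mul_tan_mul_sin h0' h1', map_mul, map_ratCast, hσ, map_intCast, hγ]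
      push_cast; ring
  have hW := denExpr_zero_ne h0 h1 hp h
  have hlon := conjugateJets_lon h0 hγ hσ hκ hτ J L n
  unfold denExpr dotExpr at hW
  rw [ha, ht] at hW
  rw [show (1 - a : ℝ) = ((1 - a : ℚ) : ℝ) by push_cast; rfl] at hW
  have hexpr (J L : Label) : distExpr x J L = fun y => normDist a ((1 - a : ℚ) : ℝ) t
      (√3 * (Real.tan (baseAngle x delta) * Real.sin (baseAngle x phi)))
      (side J * latSin x J y) (latCos x J y) (incTan x J y)
      (side L * latSin x L y) (latCos x L y) (incTan x L y)
      (Real.cos (lonAngle x J L y)) ((√3)⁻¹ * Real.sin (lonAngle x J L y)) := by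
    funext y
    rw [distExpr, ha, ht]; push_cast; rfl
  rw [hexpr, hexpr]
  exact conjugateJets_normDist a (1 - a) t u η hr (hs J) (conjugateJets_lat h0 h1 hφ J n).1
    (conjugateJets_inc h0 h1 hγ hσ hδ J n) (hs L) (conjugateJets_lat h0 h1 hφ L n).1
    (conjugateJets_inc h0 h1 hγ hσ hδ L n) hlon.1 hlon.2 hW

end Jets

/-! ### Galois conjugation and the action of the dihedral group -/

/-- The Galois conjugation of a real quadratic field. -/
theorem exists_conj {p : ℝ} (hp : Irrational p) {q : ℚ} (hq : p ^ 2 = q) :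
    ∃ conj : ℚ⟮p⟯ ≃ₐ[ℚ] ℚ⟮p⟯, conj (IntermediateField.AdjoinSimple.gen ℚ p) =
      -IntermediateField.AdjoinSimple.gen ℚ p ∧ ∀ a, conj (conj a) = a := by
  set P : ℚ[X] := .X ^ 2 - .C q with hP
  have hmonic : P.Monic := Polynomial.monic_X_pow_sub_C q two_ne_zero
  have hroot : Polynomial.aeval p P = 0 := by simp [hP, hq]
  have hirr : Irreducible P := by
    refine (hmonic.irreducible_iff_roots_eq_zero_of_degree_le_three ?_ ?_).2 ?_
    · rw [Polynomial.natDegree_X_pow_sub_C]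
    · rw [Polynomial.natDegree_X_pow_sub_C]; norm_num
    · refine Multiset.eq_zero_of_forall_notMem fun c hc => ?_
      have hc' : c ^ 2 = q := by
        have := (Polynomial.mem_roots'.1 hc).2
        simpa [hP, sub_eq_zero] using this
      have h2 : p ^ 2 = (c : ℝ) ^ 2 := by rw [hq, ← hc']; push_cast; ring
      rcases sq_eq_sq_iff_eq_or_eq_neg.1 h2 with h | h
      · exact hp.ne_rat c h
      · exact hp.ne_rat (-c) (by simpa using h)
  have hint : IsIntegral ℚ p := ⟨P, hmonic, hroot⟩
  have hmin : P = minpoly ℚ p := minpoly.eq_of_irreducible_of_monic hirr hroot hmonic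
  set γ := IntermediateField.AdjoinSimple.gen ℚ p with hγ
  have hγ2 : γ ^ 2 = algebraMap ℚ ℚ⟮p⟯ q := by
    apply (algebraMap ℚ⟮p⟯ ℝ).injective
    rw [map_pow, hγ, IntermediateField.AdjoinSimple.algebraMap_gen, hq]; rfl
  have hmem : -γ ∈ (minpoly ℚ p).aroots ℚ⟮p⟯ := by
    rw [← hmin, Polynomial.mem_aroots]
    exact ⟨hmonic.ne_zero, by simp [hP, hγ2]⟩
  set f : ℚ⟮p⟯ →ₐ[ℚ] ℚ⟮p⟯ :=
    (IntermediateField.algHomAdjoinIntegralEquiv ℚ hint).symm ⟨-γ, hmem⟩ with hf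
  have hfγ : f γ = -γ := IntermediateField.algHomAdjoinIntegralEquiv_symm_apply_gen ℚ hint _
  have hff : f.comp f = AlgHom.id ℚ ℚ⟮p⟯ := by
    refine IntermediateField.adjoin_algHom_ext ℚ ?_
    rintro a ha
    obtain rfl := Set.mem_singleton_iff.1 ha
    change f (f γ) = γ
    rw [hfγ, map_neg, hfγ, neg_neg]
  exact ⟨AlgEquiv.ofAlgHom f f hff hff, hfγ, fun a => DFunLike.congr_fun hff a⟩

section Action

variable {K : Type} [Field K]

/-- The data of `Π_ϱ`. -/
def varrhoData (K : Type) [Field K] : (K ≃+* K) × Equiv.Perm Label × (Coord → ℤˣ) :=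
  (1, varrho, 1)

/-- The data of `Π_ς`. -/
def varsigmaData (conj : K ≃+* K) : (K ≃+* K) × Equiv.Perm Label × (Coord → ℤˣ) :=
  (conj, varsigma, signs)

theorem varrhoData_mul_self : varrhoData K * varrhoData K = 1 :=
  Prod.ext (mul_one 1) (Prod.ext varrho_mul_self (mul_one 1))

theorem signs_mul_self : signs * signs = 1 := by
  funext υ; exact Int.units_mul_self _

theorem varsigmaData_mul_self {conj : K ≃+* K} (h : conj * conj = 1) :
    varsigmaData conj * varsigmaData conj = 1 :=
  Prod.ext h (Prod.ext varsigma_mul_self signs_mul_self)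

theorem varrhoData_mul_varsigmaData_sq {conj : K ≃+* K} (h : conj * conj = 1) :
    varrhoData K * varsigmaData conj * (varrhoData K * varsigmaData conj) = (1, varpi, 1) := by
  refine Prod.ext ?_ (Prod.ext varpi_eq.symm ?_)
  · change 1 * conj * (1 * conj) = 1
    rw [one_mul, h]
  · change 1 * signs * (1 * signs) = 1
    rw [one_mul, signs_mul_self]

theorem varrhoData_mul_varsigmaData_pow_six {conj : K ≃+* K} (h : conj * conj = 1) :
    (varrhoData K * varsigmaData conj) ^ 6 = 1 := by
  have h6 : (varrhoData K * varsigmaData conj) ^ 6 =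
      (varrhoData K * varsigmaData conj * (varrhoData K * varsigmaData conj)) ^ 3 := by
    rw [← sq, ← pow_mul]
  rw [h6, varrhoData_mul_varsigmaData_sq h, Prod.pow_mk, Prod.pow_mk, varpi_pow_three, one_pow,
    one_pow]
  rfl

theorem mul_mul_eq_inv_mul {G : Type*} [Group G] {a b : G} (ha : a * a = 1) (hb : b * b = 1) :
    a * (a * b) = (a * b)⁻¹ * a := by
  rw [← mul_assoc, ha, one_mul, mul_inv_rev, inv_mul_cancel_right,
    inv_eq_of_mul_eq_one_left hb]

/-- The dihedral group of order 12, realized by the data of the operators: the rotation of order 6 is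
`ϱς`, whose square is `ϖ`, and `ϱ` is a reflection. -/
noncomputable def dihedralData {conj : K ≃+* K} (h : conj * conj = 1) :
    DihedralGroup 6 →* (K ≃+* K) × Equiv.Perm Label × (Coord → ℤˣ) :=
  dihedralLift (varrhoData K * varsigmaData conj) (varrhoData K)
    (varrhoData_mul_varsigmaData_pow_six h) varrhoData_mul_self
    (mul_mul_eq_inv_mul varrhoData_mul_self (varsigmaData_mul_self h))

variable {conj : K ≃+* K} (h : conj * conj = 1)

theorem dihedralData_r_one :
    dihedralData h (.r 1) = varrhoData K * varsigmaData conj :=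
  dihedralLift_r_one _ _ _ _ _

theorem dihedralData_sr_zero : dihedralData h (.sr 0) = varrhoData K :=
  dihedralLift_sr_zero _ _ _ _ _

theorem dihedralData_r_two : dihedralData h (.r 2) = (1, varpi, 1) := by
  rw [show (.r 2 : DihedralGroup 6) = .r 1 * .r 1 from rfl, map_mul, dihedralData_r_one,
    varrhoData_mul_varsigmaData_sq h]

theorem dihedralData_sr_one : dihedralData h (.sr 1) = varsigmaData conj := by
  rw [show (.sr 1 : DihedralGroup 6) = .sr 0 * .r 1 from rfl, map_mul, dihedralData_r_one,
    dihedralData_sr_zero, ← mul_assoc, varrhoData_mul_self, one_mul]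

/-- The action of the dihedral group on the lines. -/
noncomputable def dihedralPerm : DihedralGroup 6 →* Equiv.Perm Label :=
  (MonoidHom.fst _ _).comp ((MonoidHom.snd _ _).comp (dihedralData h))

theorem dihedralPerm_r_two : dihedralPerm h (.r 2) = varpi :=
  congrArg (fun t => t.2.1) (dihedralData_r_two h)

theorem dihedralPerm_sr_zero : dihedralPerm h (.sr 0) = varrho :=
  congrArg (fun t => t.2.1) (dihedralData_sr_zero h)

theorem dihedralPerm_sr_one : dihedralPerm h (.sr 1) = varsigma :=
  congrArg (fun t => t.2.1) (dihedralData_sr_one h)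

/-- The action of the dihedral group on the polynomials in the perturbation parameters. -/
noncomputable def dihedralAut : DihedralGroup 6 →* RingAut (Forms K) :=
  (signedPermMonoidHom K).comp (dihedralData h)

theorem dihedralAut_r_two : dihedralAut h (.r 2) = opVarpi K := by
  rw [dihedralAut, MonoidHom.comp_apply, dihedralData_r_two]; rfl

theorem dihedralAut_sr_zero : dihedralAut h (.sr 0) = opVarrho K := by
  rw [dihedralAut, MonoidHom.comp_apply, dihedralData_sr_zero]; rfl

theorem dihedralAut_sr_one : dihedralAut h (.sr 1) = opVarsigma conj := by
  rw [dihedralAut, MonoidHom.comp_apply, dihedralData_sr_one]; rfl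

set_option maxRecDepth 4000 in
theorem dihedralPerm_injective : Function.Injective (dihedralPerm h) := by
  have h₁ : dihedralPerm h (.r 1) = varrho * varsigma :=
    congrArg (fun t => t.2.1) (dihedralData_r_one h)
  have h₂ := dihedralPerm_sr_zero h
  have hr (i : ZMod 6) : (.r i : DihedralGroup 6) = .r 1 ^ i.val := by
    rw [DihedralGroup.r_one_pow, ZMod.natCast_zmod_val]
  have hsr (i : ZMod 6) : (.sr i : DihedralGroup 6) = .sr 0 * .r 1 ^ i.val := by
    rw [← hr, DihedralGroup.sr_mul_r, zero_add]
  rw [injective_iff_map_eq_one]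
  rintro (i | i) hi
  · rw [hr, map_pow, h₁] at hi
    have hA := Equiv.congr_fun hi A
    revert hA
    fin_cases i
    · exact fun _ => rfl
    all_goals intro hA; exact absurd hA (by decide)
  · rw [hsr, map_mul, map_pow, h₁, h₂] at hi
    have hA := Equiv.congr_fun hi A
    have hB := Equiv.congr_fun hi B
    revert hA hB
    fin_cases i
    all_goals intro hA hB; first | exact absurd hA (by decide) | exact absurd hB (by decide)

theorem closure_eq_top :
    Subgroup.closure {.r 2, .sr 0, .sr 1} = (⊤ : Subgroup (DihedralGroup 6)) := by
  set G := Subgroup.closure {(.r 2 : DihedralGroup 6), .sr 0, .sr 1}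
  have hs : (.sr 0 : DihedralGroup 6) ∈ G := Subgroup.subset_closure (by simp)
  have ht : (.sr 1 : DihedralGroup 6) ∈ G := Subgroup.subset_closure (by simp)
  have hr1 : (.r 1 : DihedralGroup 6) ∈ G := by simpa using G.mul_mem hs ht
  have hr (i : ZMod 6) : (.r i : DihedralGroup 6) ∈ G := by
    have := G.pow_mem hr1 i.val
    rwa [DihedralGroup.r_one_pow, ZMod.natCast_zmod_val] at this
  refine (Subgroup.eq_top_iff' G).2 ?_
  rintro (i | i)
  · exact hr i
  · simpa using G.mul_mem hs (hr i)

theorem dihedralAut_injective : Function.Injective (dihedralAut h) := by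
  rw [injective_iff_map_eq_one]
  intro g hg
  exact (injective_iff_map_eq_one _).1 (dihedralPerm_injective h) g
    (eq_one_of_signedPerm_eq_one hg)

/-- A family of polynomials indexed by the pairs of lines that is permuted by the three generators is
permuted by the whole group. -/
theorem dihedralAut_apply {T : Label → Label → ℕ → Forms K}
    (ha : ∀ J L, J ≠ L → ∀ k, opVarpi K (T J L k) = T (varpi J) (varpi L) k)
    (hb : ∀ J L, J ≠ L → ∀ k, opVarrho K (T J L k) = T (varrho J) (varrho L) k)
    (hc : ∀ J L, J ≠ L → ∀ k, opVarsigma conj (T J L k) = T (varsigma J) (varsigma L) k)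
    (g : DihedralGroup 6) :
    ∀ J L, J ≠ L → ∀ k, dihedralAut h g (T J L k) =
      T (dihedralPerm h g J) (dihedralPerm h g L) k := by
  have hg : g ∈ Subgroup.closure {(.r 2 : DihedralGroup 6), .sr 0, .sr 1} := by
    rw [closure_eq_top]; trivial
  induction hg using Subgroup.closure_induction with
  | mem g hg =>
    simp only [Set.mem_insert_iff, Set.mem_singleton_iff] at hg
    rcases hg with hg | hg | hg <;> subst hg
    · rw [dihedralAut_r_two, dihedralPerm_r_two]; exact ha
    · rw [dihedralAut_sr_zero, dihedralPerm_sr_zero]; exact hb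
    · rw [dihedralAut_sr_one, dihedralPerm_sr_one]; exact hc
  | one => simp
  | mul g g' _ _ hg hg' =>
    intro J L hJL k
    rw [map_mul, map_mul, RingAut.mul_apply, hg' J L hJL k,
      hg _ _ ((dihedralPerm h g').injective.ne hJL) k]
    rfl
  | inv g _ hg =>
    intro J L hJL k
    have := hg _ _ (((dihedralPerm h g)⁻¹).injective.ne hJL) k
    rw [← Equiv.Perm.mul_apply, ← Equiv.Perm.mul_apply, mul_inv_cancel, Equiv.Perm.one_apply,
      Equiv.Perm.one_apply] at this
    rw [map_inv, map_inv, ← this]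
    exact RingEquiv.symm_apply_apply _ _

end Action

end SixLines


open SixLines
open scoped IntermediateField
theorem mainTheorem4 (x : ℚ) (hx0 : 0 < x) (hx1 : x < 1) (hp : Irrational (pX (x : ℝ))) :
    ∃ ϑ : Coord → ℝ, (∀ υ, 0 < ϑ υ) ∧
      -- (i) all squared distances are analytic, with Taylor coefficients in the field `ℚ[𝔭_x]`
      (∀ J L : Label, J ≠ L → AnalyticAt ℝ (sqDist (x : ℝ) ϑ J L) 0 ∧
        ∀ n : Label × Coord →₀ ℕ, taylorCoeff (sqDist (x : ℝ) ϑ J L) n ∈ ℚ⟮pX (x : ℝ)⟯) ∧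
      -- the Galois conjugation `𝔭_x ↦ -𝔭_x`, and the Taylor expansions over `ℚ[𝔭_x]`
      ∃ conj : ℚ⟮pX (x : ℝ)⟯ ≃ₐ[ℚ] ℚ⟮pX (x : ℝ)⟯,
        conj (IntermediateField.AdjoinSimple.gen ℚ (pX (x : ℝ))) =
          -IntermediateField.AdjoinSimple.gen ℚ (pX (x : ℝ)) ∧
      ∃ T : Label → Label → ℕ → Forms ℚ⟮pX (x : ℝ)⟯,
        (∀ J L : Label, J ≠ L → ∀ k : ℕ,
          MvPolynomial.map (algebraMap ℚ⟮pX (x : ℝ)⟯ ℝ) (T J L k) =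
            taylorPart k (sqDist (x : ℝ) ϑ J L)) ∧
        -- (ii) `Π_ϖ`, `Π_ϱ`, `Π_ς` generate a dihedral group of order 12, which acts on the
        -- expansions through the underlying permutations of the lines
        ∃ (Φ : DihedralGroup 6 →* RingAut (Forms ℚ⟮pX (x : ℝ)⟯))
          (P : DihedralGroup 6 →* Equiv.Perm Label) (a b c : DihedralGroup 6),
          Function.Injective Φ ∧ Function.Injective P ∧
          Subgroup.closure {a, b, c} = ⊤ ∧
          (Φ a = opVarpi ℚ⟮pX (x : ℝ)⟯ ∧ P a = varpi) ∧
          (Φ b = opVarrho ℚ⟮pX (x : ℝ)⟯ ∧ P b = varrho) ∧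
          (Φ c = opVarsigma conj.toRingEquiv ∧ P c = varsigma) ∧
          ∀ (g : DihedralGroup 6) (J L : Label), J ≠ L → ∀ k : ℕ,
            Φ g (T J L k) = T (P g J) (P g L) k := by
  have h0' : (0 : ℝ) < x := by exact_mod_cast hx0
  have h1' : (x : ℝ) < 1 := by exact_mod_cast hx1
  obtain ⟨conj, hconj, hinv⟩ := exists_conj hp (q := (1 + x) * (1 + 3 * x) / 3)
    (by rw [pX_sq h0']; push_cast; ring)
  have hγ : algebraMap ℚ⟮pX (x : ℝ)⟯ ℝ (IntermediateField.AdjoinSimple.gen ℚ (pX (x : ℝ))) =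
      pX x := IntermediateField.AdjoinSimple.algebraMap_gen ℚ _
  have hid : ((RingEquiv.refl ℚ⟮pX (x : ℝ)⟯ : ℚ⟮pX (x : ℝ)⟯ →+* ℚ⟮pX (x : ℝ)⟯))
      (IntermediateField.AdjoinSimple.gen ℚ (pX (x : ℝ))) =
      (((1 : ℤˣ) : ℤ) : ℚ⟮pX (x : ℝ)⟯) * IntermediateField.AdjoinSimple.gen ℚ (pX (x : ℝ)) := by
    simp
  have hneg : (conj.toRingEquiv : ℚ⟮pX (x : ℝ)⟯ →+* ℚ⟮pX (x : ℝ)⟯)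
      (IntermediateField.AdjoinSimple.gen ℚ (pX (x : ℝ))) =
      (((-1 : ℤˣ) : ℤ) : ℚ⟮pX (x : ℝ)⟯) * IntermediateField.AdjoinSimple.gen ℚ (pX (x : ℝ)) := by
    simpa using hconj
  have jet_varpi {J L : Label} (h : J ≠ L) := conjugateJets_sqDist (ε := 1) hx0 hx1 hp hγ hid rfl
    rfl rfl isSymmetry_varpi h
  have jet_varrho {J L : Label} (h : J ≠ L) := conjugateJets_sqDist (ε := 1) hx0 hx1 hp hγ hid rfl
    rfl rfl isSymmetry_varrho h
  have jet_varsigma {J L : Label} (h : J ≠ L) := conjugateJets_sqDist (ε := signs) hx0 hx1 hp hγ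
    hneg rfl rfl rfl isSymmetry_varsigma h
  have hcoeff {J L : Label} (h : J ≠ L) (n : Label × Coord →₀ ℕ) :
      ∃ a : ℚ⟮pX (x : ℝ)⟯, taylorCoeff (sqDist x (normConst x) J L) n = algebraMap _ ℝ a :=
    (ConjugateJets.taylorCoeff_eq (jet_varpi h) n).imp fun _ => And.left
  have hT : ∀ (J L : Label) (k : ℕ), ∃ P : Forms ℚ⟮pX (x : ℝ)⟯, J ≠ L →
      MvPolynomial.map (algebraMap ℚ⟮pX (x : ℝ)⟯ ℝ) P =
        taylorPart k (sqDist x (normConst x) J L) := by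
    intro J L k
    by_cases h : J = L
    · exact ⟨0, fun h' => absurd h h'⟩
    · exact (exists_map_eq_taylorPart _ (hcoeff h) k).imp fun _ hP _ => hP
  choose T hT using hT
  have hmul : conj.toRingEquiv * conj.toRingEquiv = 1 := RingEquiv.ext hinv
  refine ⟨normConst x, ?_, fun J L h => ⟨(jet_varpi h 0).1, fun n => ?_⟩, conj, hconj, T,
    fun J L h k => hT J L k h, dihedralAut hmul, dihedralPerm hmul, .r 2, .sr 0, .sr 1,
    dihedralAut_injective hmul, dihedralPerm_injective hmul, closure_eq_top,
    ⟨dihedralAut_r_two hmul, dihedralPerm_r_two hmul⟩,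
    ⟨dihedralAut_sr_zero hmul, dihedralPerm_sr_zero hmul⟩,
    ⟨dihedralAut_sr_one hmul, dihedralPerm_sr_one hmul⟩, ?_⟩
  · rintro (_ | _ | _)
    · exact Real.sqrt_pos.2 (by norm_num)
    · exact mul_pos (sin_phi_pos h0' h1') (cos_phi_pos h0' h1')
    · exact mul_pos (tan_delta_pos h0' h1') (pX_pos h0')
  · obtain ⟨a, ha⟩ := hcoeff h n
    rw [ha]
    exact a.2
  · exact dihedralAut_apply hmul
      (fun J L h k => signedPerm_eq_of_conjugateJets (jet_varpi h) (hT J L k h)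
        (hT _ _ k (varpi.injective.ne h)))
      (fun J L h k => signedPerm_eq_of_conjugateJets (jet_varrho h) (hT J L k h)
        (hT _ _ k (varrho.injective.ne h)))
      (fun J L h k => signedPerm_eq_of_conjugateJets (jet_varsigma h) (hT J L k h)
        (hT _ _ k (varsigma.injective.ne h)))
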